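/- **Theorem (optimum with multidimensional state).** Let $r>0$, $n$ a number of components, and for $i=1,\dots,n$ let $\sigma_i>0$, $\sigma_{0,i}\ge 0$, $2\kappa_i<r$, with $\kappa_1\le\dots\le\kappa_n$; let $\beta\in\mathbf R^n$. (Component $i$ of the state has initial variance $\sigma_{0,i}^2$ and follows $d\theta_{t,i}=\kappa_i\theta_{t,i}\,dt+\sigma_i\,dZ_{t,i}$, independently of the others.) Let $\eta_i(v,h)=e^{2\kappa_i h}v+(e^{2\kappa_i h}-1)\frac{\sigma_i^2}{2\kappa_i}$. The sender chooses a bias path $b:[0,\infty)\to\mathbf R^n$ (measurable) and a variance path $v:[0,\infty)\to\mathbf R^n$ to maximize $$-\int_0^\infty re^{-rt}\sum_{i=1}^n\big[(b_i(t)-\beta_i)^2+v_i(t)\big]\,dt$$ subject to $$-\int_t^\infty re^{-r(s-t)}\sum_{i=1}^n\big[b_i^2(s)+v_i(s)\big]\,ds\ \ge\ -\sum_{i=1}^n\frac{\sigma_i^2+rv_i(t)}{r-2\kappa_i}\quad(t\ge0),$$ $0\le v_i(s)\le\eta_i(v_i(t),s-t)$ for $s>t\ge0$, and $0\le v_i(0)\le\sigma_{0,i}^2$,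 for all $i$. Put $\hat\sigma_j^2=\sum_{i=1}^j\sigma_i^2/(r-2\kappa_i)$ and $\hat\sigma=\hat\sigma_n$. Expressions with $\kappa_i$ in a denominator are replaced by their limits if $\kappa_i=0$; $x_+=\max\{x,0\}$ and $t_0=0$. The following paths $(\hat b,\hat v)$ are optimal. If $\kappa_1<\dots<\kappa_n$, the optimum is unique: every optimal $(b,v)$ satisfies $b(t)=\hat b(t)$ for almost every $t\geq 0$ and $v(t)=\hat v(t)$ for every $t>0$. I. If $\|\beta\|\le\hat\sigma$, then $\hat b(t)=\beta$ and $\hat v(t)=0$ for all $t$. II. If $\|\beta\|>\hat\sigma$, there are a unique critical component $i_0\in\{1,\dots,n+1\}$ and unique full-disclosure times $0=t_1=\dots=t_{i_0-1}<t_{i_0}<\dots<t_n$ such that the paths $$\hat b(t)=\hat\sigma\exp\Big(\sum_{i=i_0}^n(r-2\kappa_i)\big(t_i-\max\{t,t_{i-1}\}\big)_+\Big)\frac{\beta}{\|\beta\|},$$ $\hat v_i(t)=0$ for $i<i_0$, and, for $i\ge i_0$, $$\hat v_i(t)=\frac{\hat\sigma_i^2(r-2\kappa_i)}{2\kappa_i}\big(e^{-2\kappa_i(t_i-t)_+}-1\big)+\frac{\hat\sigma^2(r-2\kappa_i)e^{2\tau_{i+1}}}{2(r-\kappa_i)}\big(e^{2(r-2\kappa_i)(t_i-t)_+}-e^{-2\kappa_i(t_i-t)_+}\big)\quad(t\ge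 t_{i-1}),$$ $$\hat v_i(t)=-\frac{\sigma_i^2}{2\kappa_i}+\Big(\hat v_i(t_{i-1})+\frac{\sigma_i^2}{2\kappa_i}\Big)e^{2\kappa_i(t-t_{i-1})}\quad(t<t_{i-1}),$$ where $\tau_j=\sum_{i=j}^n(r-2\kappa_i)(t_i-t_{i-1})$, satisfy: (i) $\|\hat b(0)\|\le\|\beta\|$, $\hat v_{i_0}(0)\le\sigma_{0,i_0}^2$ (if $i_0\le n$), and $\hat v_i(0)=\sigma_{0,i}^2$ for $i>i_0$; (ii) $\|\hat b(0)\|=\|\beta\|$, or $\hat v_i(0)=\sigma_{0,i}^2$ for all $i$. Moreover, $i_0=n+1$ if and only if $\sigma_{0,i}=0$ for all $i$. The magnitude $\|\hat b\|$ decays exponentially at rate $r-2\kappa_i$ on $[t_{i-1},t_i]$, and component $i$ is fully revealed exactly from $t_i$ on: for $t>0$, $\hat v_i(t)=0$ if and only if $t\ge t_i$. -/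

import Mathlib

open MeasureTheory Set

noncomputable section

/-- The data of the problem with an `n`-dimensional state: discount rate `r`; for every component
`i` the persistence `κ i`, the volatility `σ i` and the standard deviation `σ₀ i` of the initial
state (so that the state component `i` solves `dθ = κ i θ dt + σ i dZ`, `Var θ₀ = (σ₀ i)²`); and
the sender's preference bias `β`. The conditions on these numbers are hypotheses of the theorem. -/
structure OUModel (n : ℕ) where
  r : ℝ
  κ : Fin n → ℝ
  σ : Fin n → ℝ
  σ₀ : Fin n → ℝ
  β : EuclideanSpace ℝ (Fin n)

/-- `(exp (2 κ h) - 1) / (2 κ)`, with its limit `h` at `κ = 0`. -/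
def expGap (κ h : ℝ) : ℝ :=
  if κ = 0 then h else (Real.exp (2 * κ * h) - 1) / (2 * κ)

namespace OUModel

variable {n : ℕ}

/-- The price `r - 2 κ i` of squared bias in units of the variance of component `i`. -/
def price (M : OUModel n) (i : Fin n) : ℝ := M.r - 2 * M.κ i

/-- The variance-updating function `η i v h`: the posterior variance of component `i` at time
`t + h` if it is `v` at time `t` and no information is provided in between. It equals
`exp (2 κ h) v + (exp (2 κ h) - 1) σ² / (2 κ)`, and `v + σ² h` if `κ = 0`. -/
def η (M : OUModel n) (i : Fin n) (v h : ℝ) : ℝ :=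
  Real.exp (2 * M.κ i * h) * v + M.σ i ^ 2 * expGap (M.κ i) h

/-- The sender's payoff from the bias path `b` and the variance path `v`. -/
def payoff (M : OUModel n) (b : ℝ → EuclideanSpace ℝ (Fin n)) (v : ℝ → Fin n → ℝ) : ℝ :=
  -∫ t in Ioi (0 : ℝ), M.r * Real.exp (-M.r * t) * ∑ i, ((b t i - M.β i) ^ 2 + v t i)

/-- The constraints of the sender's problem; paths are functions on `[0, ∞)`, so that only their
values at nonnegative times matter. The field `integrable` says that the receiver's expected
discounted loss is finite; it is the content of the obedience constraint at time `0` when the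
integral there is read with values in `[0, ∞]`, and it makes all the integrals genuine. (The
measurability of `v` follows from `noDisclosure`.) -/
structure Feasible (M : OUModel n) (b : ℝ → EuclideanSpace ℝ (Fin n)) (v : ℝ → Fin n → ℝ) :
    Prop where
  measurable : AEStronglyMeasurable b (volume.restrict (Ici (0 : ℝ)))
  integrable : IntegrableOn
    (fun s => Real.exp (-M.r * s) * ∑ i, (b s i ^ 2 + v s i)) (Ici (0 : ℝ))
  obedience : ∀ t, 0 ≤ t →
    -∑ i, (M.σ i ^ 2 + M.r * v t i) / M.price i ≤
      -∫ s in Ioi t, M.r * Real.exp (-M.r * (s - t)) * ∑ i, (b s i ^ 2 + v s i)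
  nonneg : ∀ i t, 0 ≤ t → 0 ≤ v t i
  noDisclosure : ∀ i t s, 0 ≤ t → t < s → v s i ≤ M.η i (v t i) (s - t)
  initial : ∀ i, v 0 i ≤ M.σ₀ i ^ 2

/-- `(b, v)` solves the sender's problem. -/
def IsOptimal (M : OUModel n) (b : ℝ → EuclideanSpace ℝ (Fin n)) (v : ℝ → Fin n → ℝ) : Prop :=
  M.Feasible b v ∧ ∀ b' v', M.Feasible b' v' → M.payoff b' v' ≤ M.payoff b v

/-- Every solution of the sender's problem has the bias path `b` at almost every time and the
variance path `v` at every positive time. -/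
def IsOnlyOptimum (M : OUModel n) (b : ℝ → EuclideanSpace ℝ (Fin n)) (v : ℝ → Fin n → ℝ) :
    Prop :=
  ∀ b' v', M.IsOptimal b' v' →
    (∀ᵐ t ∂(volume.restrict (Ici (0 : ℝ))), b' t = b t) ∧ ∀ t, 0 < t → v' t = v t

/-- `σ̂_i² = ∑_{j ≤ i} σ_j² / (r - 2 κ_j)`. -/
def sigmaHatSq (M : OUModel n) (i : Fin n) : ℝ := ∑ j ∈ Finset.Iic i, M.σ j ^ 2 / M.price j

/-- `σ̂ = σ̂_n`. -/
def sigmaHat (M : OUModel n) : ℝ := Real.sqrt (∑ j, M.σ j ^ 2 / M.price j)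

/-! Full-disclosure times are given as `T : Fin (n + 1) → ℝ` with `T 0 = 0`. For a component
`i : Fin n`, `T i.succ` is its own full-disclosure time and `T i.castSucc` is the one of the
preceding component (`0` for the first component). The critical component is given as
`c : Fin (n + 1)`: the components `i` with `i.castSucc < c` precede it, `c ≤ i.castSucc` holds for
the critical component and the later ones, and `c = Fin.last n` means that no component is
critical (the index would be `n + 1`). -/

/-- The bias path with critical component `c` and full-disclosure times `T`. -/
def biasPath (M : OUModel n) (c : Fin (n + 1)) (T : Fin (n + 1) → ℝ) (t : ℝ) :
    EuclideanSpace ℝ (Fin n) :=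
  (M.sigmaHat * Real.exp (∑ i : Fin n with c ≤ i.castSucc,
    M.price i * max (T i.succ - max t (T i.castSucc)) 0)) • (‖M.β‖⁻¹ • M.β)

/-- `τ_{i+1} = ∑_{j > i} (r - 2 κ_j) (t_j - t_{j-1})`. -/
def tauSucc (M : OUModel n) (T : Fin (n + 1) → ℝ) (i : Fin n) : ℝ :=
  ∑ j ∈ Finset.Ioi i, M.price j * (T j.succ - T j.castSucc)

/-- The variance of component `i` from the preceding full-disclosure time on:
`σ̂_i² (r - 2κ_i) / (2κ_i) (exp (-2κ_i (t_i - t)₊) - 1)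
  + σ̂² (r - 2κ_i) exp (2τ_{i+1}) / (2(r - κ_i))
    (exp (2(r - 2κ_i) (t_i - t)₊) - exp (-2κ_i (t_i - t)₊))`,
with the first summand replaced by its limit if `κ_i = 0`. -/
def varLate (M : OUModel n) (T : Fin (n + 1) → ℝ) (i : Fin n) (t : ℝ) : ℝ :=
  M.sigmaHatSq i * M.price i * expGap (M.κ i) (-max (T i.succ - t) 0) +
    M.sigmaHat ^ 2 * M.price i * Real.exp (2 * M.tauSucc T i) / (2 * (M.r - M.κ i)) *
      (Real.exp (2 * M.price i * max (T i.succ - t) 0) -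
        Real.exp (-2 * M.κ i * max (T i.succ - t) 0))

/-- The variance path with critical component `c` and full-disclosure times `T`. Before the
preceding full-disclosure time `t_{i-1}`, it is
`-σ_i² / (2κ_i) + (v_i(t_{i-1}) + σ_i² / (2κ_i)) exp (2κ_i (t - t_{i-1}))`, the no-disclosure
path through the value at `t_{i-1}`. -/
def varPath (M : OUModel n) (c : Fin (n + 1)) (T : Fin (n + 1) → ℝ) (t : ℝ) (i : Fin n) : ℝ :=
  if i.castSucc < c then 0
  else if T i.castSucc ≤ t then M.varLate T i t
  else M.η i (M.varLate T i (T i.castSucc)) (t - T i.castSucc)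

/-- The conditions that pin down the critical component and the full-disclosure times:
`0 = t_1 = ⋯ = t_{i₀-1} < t_{i₀} < ⋯ < t_n`; the initial bias is at most `‖β‖`; the initial
variance constraint holds for the critical component and binds for the later ones; and the
initial bias is `‖β‖` or the initial variance constraint binds for all components. -/
structure IsSchedule (M : OUModel n) (c : Fin (n + 1)) (T : Fin (n + 1) → ℝ) : Prop where
  zero : T 0 = 0
  before : ∀ i : Fin n, i.castSucc < c → T i.succ = 0
  strict : ∀ i : Fin n, c ≤ i.castSucc → T i.castSucc < T i.succ
  bias_le : ‖M.biasPath c T 0‖ ≤ ‖M.β‖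
  critical : ∀ i : Fin n, i.castSucc = c → M.varPath c T 0 i ≤ M.σ₀ i ^ 2
  later : ∀ i : Fin n, c < i.castSucc → M.varPath c T 0 i = M.σ₀ i ^ 2
  tight : ‖M.biasPath c T 0‖ = ‖M.β‖ ∨ ∀ i, M.varPath c T 0 i = M.σ₀ i ^ 2

end OUModel

end

/-!
The sender's problem is a convex program, solved by a Lagrangian. Write `p i = r - 2 κ i`.

*Duality.* Put a multiplier on each obedience constraint and let `m t` be one plus the cumulative
multiplier up to time `t` (`multiplier`). Minimizing the Lagrangian over the bias gives
`b t = β / m t`, so `m` grows at the rate at which the bias decays. If this rate is `q t`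
(`decayRate`), the variance of component `i` enters the Lagrangian at time `t` with the coefficient
`m t (1 - q t / p i)`. Hence the optimal variance is `0` while `q < p i` and as large as the
no-disclosure flow from `σ₀ i ^ 2` allows while `q > p i`; at `q = p i` the sender is indifferent.
Since `p` is nonincreasing, the components are revealed one after the other. During the partial
disclosure of component `i` its variance is the one that keeps obedience binding (`late`), which
makes the obedience constraints of the proposed paths equalities at all times
(`integral_lossFlow_eq`). Summation by parts (`integral_decayRate_mul`) then writes the loss from
any other feasible pair as the integral of a nonnegative density (`dualGap`) plus a nonnegative
term from time `0` (`payoff_sub_payoff`, `multiplier_zero_sub_one_mul_nonpos`).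

*Uniqueness of the optimum.* For another optimum the density vanishes. This fixes the bias and, if
`κ` is strictly increasing, all variances but that of the component being revealed; the difference
of the continuation losses then solves a linear differential equation and tends to `0`, so it
vanishes, too. Pathwise equality at positive times follows because feasible variances, transported
back along the no-disclosure flow, are antitone.

*The schedule.* Given the last full-disclosure time `S`, the other ones are determined backward:
component `i` starts to be partially revealed at the time at which the initial variance required
for this (`requiredVar`) is `σ₀ i ^ 2`, or at time `0` if the required variance is smaller
(`IsStart`, `stage`). In terms of the full-disclosure time and the logarithmic bias extrapolated to
time `0`, each backward step is continuous (`continuousOn_stage`) and, because `p` is nonincreasing,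
monotone (`stage_lt`). So the initial bias, and the initial variance required of the first
component with uncertainty, increase with `S`, and the schedule is given by the unique `S` at which
the first of the two bounds on them is reached. Without any initial uncertainty, all full-disclosure
times are `0`.
-/

noncomputable section

/-! ### The no-disclosure flow -/

theorem hasDerivAt_expGap (κ h : ℝ) : HasDerivAt (expGap κ) (Real.exp (2 * κ * h)) h := by
  unfold expGap
  by_cases hκ : κ = 0
  · simpa [hκ] using hasDerivAt_id' h
  · simp only [hκ, if_false]
    have h1 : HasDerivAt (fun h : ℝ => 2 * κ * h) (2 * κ) h := by
      simpa using (hasDerivAt_id' h).const_mul (2 * κ)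
    refine ((h1.exp.sub_const 1).div_const (2 * κ)).congr_deriv ?_
    rw [mul_div_assoc, div_self (by simpa using hκ), mul_one]

@[simp] theorem expGap_zero (κ : ℝ) : expGap κ 0 = 0 := by simp [expGap]

theorem continuous_expGap (κ : ℝ) : Continuous (expGap κ) :=
  continuous_iff_continuousAt.2 fun h => (hasDerivAt_expGap κ h).continuousAt

theorem strictMono_expGap (κ : ℝ) : StrictMono (expGap κ) :=
  strictMono_of_deriv_pos fun h => by
    rw [(hasDerivAt_expGap κ h).deriv]
    positivity

theorem expGap_nonneg {κ h : ℝ} (hh : 0 ≤ h) : 0 ≤ expGap κ h := by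
  simpa using (strictMono_expGap κ).monotone hh

theorem two_mul_mul_expGap (κ h : ℝ) : 2 * κ * expGap κ h = Real.exp (2 * κ * h) - 1 := by
  unfold expGap
  split_ifs with h0
  · simp [h0]
  · rw [mul_div_cancel₀ _ (by simpa using h0)]

theorem expGap_add (κ a b : ℝ) :
    expGap κ (a + b) = Real.exp (2 * κ * b) * expGap κ a + expGap κ b := by
  unfold expGap
  split_ifs with h
  · simp [h]
  · rw [mul_add, Real.exp_add]
    field_simp
    ring

/-- An antitone function that agrees almost everywhere with a continuous one agrees with it
everywhere in the interior. -/
theorem AntitoneOn.eq_of_ae_eq_continuousOn {f g : ℝ → ℝ} (hf : AntitoneOn f (Ici 0))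
    (hg : ContinuousOn g (Ici 0)) (h : ∀ᵐ t ∂volume.restrict (Ioi (0 : ℝ)), f t = g t) {t : ℝ}
    (ht : 0 < t) : f t = g t := by
  have hgt : ContinuousAt g t := hg.continuousAt (Ici_mem_nhds ht)
  have key : ∀ a b, 0 ≤ a → a < b → ∃ u ∈ Ioo a b, f u = g u := by
    intro a b ha hab
    by_contra! hne
    have h0 : volume.restrict (Ioi (0 : ℝ)) (Ioo a b) = 0 :=
      measure_mono_null (fun u hu => hne u hu) h
    have hsub : Ioo a b ⊆ Ioi 0 := fun u hu => ha.trans_lt hu.1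
    rw [Measure.restrict_apply measurableSet_Ioo, inter_eq_left.2 hsub, Real.volume_Ioo] at h0
    simp only [ENNReal.ofReal_eq_zero, tsub_le_iff_right, zero_add] at h0
    exact absurd hab (not_lt.2 h0)
  apply le_antisymm
  · by_contra! hlt
    obtain ⟨l, hl, hl'⟩ := (mem_nhdsLE_iff_exists_Ioc_subset' ht).1
      (mem_nhdsWithin_of_mem_nhds (hgt.eventually_lt_const hlt))
    obtain ⟨u, hu, hfu⟩ := key (max l 0) t (le_max_right _ _) (max_lt hl ht)
    have h1 : g u < f t := hl' ⟨(le_max_left _ _).trans_lt hu.1, hu.2.le⟩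
    have h2 : f t ≤ f u := hf ((le_max_right _ _).trans hu.1.le) ht.le hu.2.le
    linarith
  · by_contra! hlt
    obtain ⟨l, hl, hl'⟩ := (mem_nhdsGE_iff_exists_Ico_subset' (lt_add_one t)).1
      (mem_nhdsWithin_of_mem_nhds (hgt.eventually_const_lt hlt))
    obtain ⟨u, hu, hfu⟩ := key t l ht.le hl
    have h1 : f t < g u := hl' ⟨hu.1.le, hu.2⟩
    have h2 : f u ≤ f t := hf ht.le (ht.trans hu.1).le hu.1.le
    linarith

namespace OUModel

variable {n : ℕ} (M : OUModel n)

@[simp] theorem eta_zero (i : Fin n) (v : ℝ) : M.η i v 0 = v := by simp [η]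

theorem eta_eta (i : Fin n) (v a b : ℝ) : M.η i (M.η i v a) b = M.η i v (a + b) := by
  simp only [η, expGap_add, mul_add, Real.exp_add]
  ring

theorem strictMono_eta (i : Fin n) (h : ℝ) : StrictMono fun v => M.η i v h := fun v w hvw => by
  have := mul_lt_mul_of_pos_left hvw (Real.exp_pos (2 * M.κ i * h))
  simpa [η] using this

theorem eta_le_eta {i : Fin n} {v w : ℝ} (h : ℝ) (hvw : v ≤ w) : M.η i v h ≤ M.η i w h :=
  (M.strictMono_eta i h).monotone hvw

theorem eta_nonneg {i : Fin n} {v h : ℝ} (hv : 0 ≤ v) (hh : 0 ≤ h) : 0 ≤ M.η i v h :=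
  add_nonneg (mul_nonneg (Real.exp_pos _).le hv) (mul_nonneg (sq_nonneg _) (expGap_nonneg hh))

theorem eta_pos {i : Fin n} (hσ : ∀ i, 0 < M.σ i) {v h : ℝ} (hv : 0 ≤ v) (hh : 0 < h) :
    0 < M.η i v h := by
  have h1 : 0 < expGap (M.κ i) h := by simpa using strictMono_expGap (M.κ i) hh
  exact add_pos_of_nonneg_of_pos (mul_nonneg (Real.exp_pos _).le hv)
    (mul_pos (pow_pos (hσ i) 2) h1)

/-- The no-disclosure constraint says that the variance, transported back to time `0` along the
no-disclosure flow, never increases. -/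
theorem le_eta_sub_iff (i : Fin n) (x y t s : ℝ) :
    y ≤ M.η i x (s - t) ↔ M.η i y (-s) ≤ M.η i x (-t) := by
  rw [← (M.strictMono_eta i (-s)).le_iff_le, eta_eta]
  congr! 2
  ring

/-- The variance transported back to time `0` moves only as far as the drift of the variance
deviates from the no-disclosure drift `2 κ v + σ²`. -/
theorem hasDerivWithinAt_eta_neg {i : Fin n} {v : ℝ → ℝ} {v' t : ℝ} {s : Set ℝ}
    (h : HasDerivWithinAt v v' s t) :
    HasDerivWithinAt (fun t => M.η i (v t) (-t))
      (Real.exp (-(2 * M.κ i * t)) * (v' - 2 * M.κ i * v t - M.σ i ^ 2)) s t := by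
  have h1 : HasDerivAt (fun t : ℝ => -t) (-1) t := hasDerivAt_neg t
  have h2 : HasDerivAt (fun t : ℝ => 2 * M.κ i * -t) (2 * M.κ i * -1) t := h1.const_mul _
  have h3 : HasDerivAt (fun t : ℝ => expGap (M.κ i) (-t)) (Real.exp (2 * M.κ i * -t) * -1) t :=
    (hasDerivAt_expGap (M.κ i) (-t)).comp t h1
  have h4 := (h2.exp.hasDerivWithinAt.mul h).add (h3.hasDerivWithinAt.const_mul (M.σ i ^ 2))
  refine h4.congr_deriv ?_
  rw [show 2 * M.κ i * -t = -(2 * M.κ i * t) by ring]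
  ring

theorem Feasible.antitoneOn {M : OUModel n} {b : ℝ → EuclideanSpace ℝ (Fin n)}
    {v : ℝ → Fin n → ℝ} (h : M.Feasible b v) (i : Fin n) :
    AntitoneOn (fun t => M.η i (v t i) (-t)) (Ici 0) := fun t ht s _ hts => by
  rcases hts.eq_or_lt with rfl | hlt
  · exact le_rfl
  · exact (M.le_eta_sub_iff i _ _ t s).1 (h.noDisclosure i t s ht hlt)

theorem Feasible.le_eta_initial {M : OUModel n} {b : ℝ → EuclideanSpace ℝ (Fin n)}
    {v : ℝ → Fin n → ℝ} (h : M.Feasible b v) (i : Fin n) {t : ℝ} (ht : 0 ≤ t) :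
    v t i ≤ M.η i (M.σ₀ i ^ 2) t := by
  have h1 := h.antitoneOn i (mem_Ici.2 le_rfl) ht ht
  simp only [neg_zero, eta_zero] at h1
  have h2 := M.eta_le_eta (i := i) t (h1.trans (h.initial i))
  simpa [eta_eta] using h2

/-! ### The variance during partial disclosure -/

/-- The variance of component `i` a time `x` before its full disclosure, if at full disclosure the
logarithm of the ratio of the bias to its final value `σ̂` is `τ`, and the bias decays at rate
`price i`. -/
def late (i : Fin n) (τ x : ℝ) : ℝ :=
  M.sigmaHatSq i * M.price i * expGap (M.κ i) (-x) +
    M.sigmaHat ^ 2 * M.price i * Real.exp (2 * τ) / (2 * (M.r - M.κ i)) *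
      (Real.exp (2 * M.price i * x) - Real.exp (-2 * M.κ i * x))

@[simp] theorem late_zero (i : Fin n) (τ : ℝ) : M.late i τ 0 = 0 := by simp [late]

theorem price_pos (hκ : ∀ i, 2 * M.κ i < M.r) (i : Fin n) : 0 < M.price i :=
  sub_pos.2 (hκ i)

theorem antitone_price (hmono : Monotone M.κ) : Antitone M.price := fun i j hij => by
  have := hmono hij
  simp only [price]
  linarith

theorem r_sub_kappa_pos (hr : 0 < M.r) (hκ : ∀ i, 2 * M.κ i < M.r) (i : Fin n) :
    0 < M.r - M.κ i := by linarith [hκ i]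

theorem sigmaHat_sq (hκ : ∀ i, 2 * M.κ i < M.r) :
    M.sigmaHat ^ 2 = ∑ j, M.σ j ^ 2 / M.price j :=
  Real.sq_sqrt (Finset.sum_nonneg fun j _ => div_nonneg (sq_nonneg _) (M.price_pos hκ j).le)

theorem sigmaHatSq_le (hκ : ∀ i, 2 * M.κ i < M.r) (i : Fin n) :
    M.sigmaHatSq i ≤ M.sigmaHat ^ 2 := by
  rw [M.sigmaHat_sq hκ]
  exact Finset.sum_le_sum_of_subset_of_nonneg (Finset.subset_univ _)
    fun j _ _ => div_nonneg (sq_nonneg _) (M.price_pos hκ j).le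

theorem sigmaHatSq_eq (i : Fin n) :
    M.sigmaHatSq i = ∑ j ∈ Finset.Iio i, M.σ j ^ 2 / M.price j + M.σ i ^ 2 / M.price i := by
  have : Finset.Iic i = insert i (Finset.Iio i) := by
    ext j
    simp [le_iff_eq_or_lt]
  rw [sigmaHatSq, this, Finset.sum_insert (by simp), add_comm]

theorem sigmaHat_pos (hσ : ∀ i, 0 < M.σ i) (hκ : ∀ i, 2 * M.κ i < M.r) (i : Fin n) :
    0 < M.sigmaHat := by
  refine Real.sqrt_pos.2 (Finset.sum_pos (fun j _ => ?_) ⟨i, Finset.mem_univ i⟩)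
  exact div_pos (pow_pos (hσ j) 2) (M.price_pos hκ j)

/-- The evolution of the variance, in the time to full disclosure, that keeps obedience binding
while the bias decays at rate `price i`. -/
theorem hasDerivAt_late (hr : 0 < M.r) (hκ : ∀ i, 2 * M.κ i < M.r) (i : Fin n) (τ x : ℝ) :
    HasDerivAt (M.late i τ)
      (-(2 * M.κ i) * M.late i τ x + M.price i *
        (M.sigmaHat ^ 2 * Real.exp (2 * τ + 2 * M.price i * x) - M.sigmaHatSq i)) x := by
  have h0 : M.r - M.κ i ≠ 0 := (M.r_sub_kappa_pos hr hκ i).ne'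
  have h1 := (hasDerivAt_expGap (M.κ i) (-x)).comp x (hasDerivAt_neg x)
  have h2 : HasDerivAt (fun x : ℝ => 2 * M.price i * x) (2 * M.price i) x := by
    simpa using (hasDerivAt_id' x).const_mul (2 * M.price i)
  have h3 : HasDerivAt (fun x : ℝ => -2 * M.κ i * x) (-2 * M.κ i) x := by
    simpa using (hasDerivAt_id' x).const_mul (-2 * M.κ i)
  refine ((h1.const_mul (M.sigmaHatSq i * M.price i)).add ((h2.exp.sub h3.exp).const_mul
    (M.sigmaHat ^ 2 * M.price i * Real.exp (2 * τ) / (2 * (M.r - M.κ i))))).congr_deriv ?_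
  have h5 : M.price i = M.r - 2 * M.κ i := rfl
  have h6 : 2 * M.κ i * -x = -2 * M.κ i * x := by ring
  have h4 : 2 * M.κ i * expGap (M.κ i) (-x) = Real.exp (-2 * M.κ i * x) - 1 := by
    rw [two_mul_mul_expGap, h6]
  rw [late, Real.exp_add, h6]
  generalize Real.exp (-2 * M.κ i * x) = A at *
  generalize Real.exp (2 * M.price i * x) = B at *
  generalize expGap (M.κ i) (-x) = C at *
  generalize Real.exp (2 * τ) = D at *
  have h7 : -(2 * M.κ i) * (M.sigmaHatSq i * M.price i * C) =
      - (M.sigmaHatSq i * M.price i) * (A - 1) := by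
    rw [← h4]
    ring
  rw [mul_add, h7, h5]
  field_simp
  ring

theorem continuous_late (hr : 0 < M.r) (hκ : ∀ i, 2 * M.κ i < M.r) (i : Fin n) (τ : ℝ) :
    Continuous (M.late i τ) :=
  continuous_iff_continuousAt.2 fun x => (M.hasDerivAt_late hr hκ i τ x).continuousAt

theorem exp_price_sub_exp_pos (hr : 0 < M.r) (hκ : ∀ i, 2 * M.κ i < M.r) (i : Fin n) {x : ℝ}
    (hx : 0 < x) : 0 < Real.exp (2 * M.price i * x) - Real.exp (-2 * M.κ i * x) := by
  refine sub_pos.2 (Real.exp_lt_exp.2 ?_)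
  have h := M.r_sub_kappa_pos hr hκ i
  have : M.price i = M.r - 2 * M.κ i := rfl
  rw [this]
  nlinarith [mul_pos h hx]

theorem late_le_late (hr : 0 < M.r) (hκ : ∀ i, 2 * M.κ i < M.r) (i : Fin n) {τ τ' x : ℝ}
    (hx : 0 ≤ x) (h : τ ≤ τ') : M.late i τ x ≤ M.late i τ' x := by
  have h0 := M.r_sub_kappa_pos hr hκ i
  have hp := M.price_pos hκ i
  rcases hx.eq_or_lt with rfl | hx
  · simp
  have h1 := (M.exp_price_sub_exp_pos hr hκ i hx).le
  unfold late
  gcongr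

theorem late_lt_late (hr : 0 < M.r) (hσ : ∀ i, 0 < M.σ i) (hκ : ∀ i, 2 * M.κ i < M.r) (i : Fin n)
    {τ τ' x : ℝ} (hx : 0 < x) (h : τ < τ') : M.late i τ x < M.late i τ' x := by
  have h0 := M.r_sub_kappa_pos hr hκ i
  have hp := M.price_pos hκ i
  have h1 := M.exp_price_sub_exp_pos hr hκ i hx
  have h2 := M.sigmaHat_pos hσ hκ i
  unfold late
  gcongr

/-- The bias exceeds `σ̂ ≥ σ̂_i` before full disclosure, so there is variance left. -/
theorem late_pos (hr : 0 < M.r) (hσ : ∀ i, 0 < M.σ i) (hκ : ∀ i, 2 * M.κ i < M.r) (i : Fin n)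
    {τ x : ℝ} (hτ : 0 ≤ τ) (hx : 0 < x) : 0 < M.late i τ x := by
  have hd : ∀ y, HasDerivAt (fun y => Real.exp (2 * M.κ i * y) * M.late i τ y)
      (Real.exp (2 * M.κ i * y) * (M.price i *
        (M.sigmaHat ^ 2 * Real.exp (2 * τ + 2 * M.price i * y) - M.sigmaHatSq i))) y := by
    intro y
    have h2 : HasDerivAt (fun x : ℝ => 2 * M.κ i * x) (2 * M.κ i) y := by
      simpa using (hasDerivAt_id' y).const_mul (2 * M.κ i)
    refine (h2.exp.mul (M.hasDerivAt_late hr hκ i τ y)).congr_deriv ?_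
    ring
  have hmono : StrictMonoOn (fun y => Real.exp (2 * M.κ i * y) * M.late i τ y) (Ici 0) := by
    refine strictMonoOn_of_deriv_pos (convex_Ici 0)
      (fun y _ => (hd y).continuousAt.continuousWithinAt) fun y hy => ?_
    rw [interior_Ici] at hy
    rw [(hd y).deriv]
    have hp := M.price_pos hκ i
    have hs := M.sigmaHat_pos hσ hκ i
    have h1 : 1 < Real.exp (2 * τ + 2 * M.price i * y) :=
      Real.one_lt_exp_iff.2 (by have := mul_pos hp hy; linarith)
    have h2 := M.sigmaHatSq_le hκ i
    have h3 : M.sigmaHat ^ 2 * 1 < M.sigmaHat ^ 2 * Real.exp (2 * τ + 2 * M.price i * y) := by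
      gcongr
    have h4 : 0 < M.sigmaHat ^ 2 * Real.exp (2 * τ + 2 * M.price i * y) - M.sigmaHatSq i := by
      linarith
    positivity
  have h := hmono (mem_Ici.2 le_rfl) (mem_Ici.2 hx.le) hx
  simp only [late_zero, mul_zero] at h
  exact pos_of_mul_pos_right h (Real.exp_pos _).le

/-- The initial variance of component `i` that leads, without disclosure up to time `t`, to the
start of partial disclosure at `t`, if full disclosure is at `T` and `U` is the logarithm of the
bias over `σ̂`, extrapolated back to time `0` at the rate `price i`. The parameter `U` is used
because full-disclosure times and the values of `U` are comonotone across schedules. -/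
def requiredVar (i : Fin n) (U T t : ℝ) : ℝ :=
  M.η i (M.late i (U - M.price i * T) (T - t)) (-t)

variable {M}

theorem hasDerivAt_requiredVar (hr : 0 < M.r) (hκ : ∀ i, 2 * M.κ i < M.r) (i : Fin n)
    (U T t : ℝ) : HasDerivAt (M.requiredVar i U T) (-(Real.exp (-(2 * M.κ i * t)) * (M.price i *
      (M.sigmaHat ^ 2 * Real.exp (2 * (U - M.price i * t)) - M.sigmaHatSq i) + M.σ i ^ 2))) t := by
  have h1 : HasDerivAt (fun t : ℝ => T - t) (-1) t := by
    simpa using (hasDerivAt_id' t).const_sub T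
  have h2 := ((M.hasDerivAt_late hr hκ i (U - M.price i * T) (T - t)).comp t h1).hasDerivWithinAt
    (s := univ)
  have h3 := M.hasDerivWithinAt_eta_neg (i := i) h2
  rw [hasDerivWithinAt_univ] at h3
  refine h3.congr_deriv ?_
  rw [show 2 * (U - M.price i * T) + 2 * M.price i * (T - t) = 2 * (U - M.price i * t) by ring]
  simp only [Function.comp_apply]
  ring

theorem requiredVar_strictAntiOn (hr : 0 < M.r) (hσ : ∀ i, 0 < M.σ i)
    (hκ : ∀ i, 2 * M.κ i < M.r) (i : Fin n) {U T : ℝ} (hU : M.price i * T ≤ U) :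
    StrictAntiOn (M.requiredVar i U T) (Iic T) := by
  refine strictAntiOn_of_deriv_neg (convex_Iic T)
    (fun t _ => (hasDerivAt_requiredVar hr hκ i U T t).continuousAt.continuousWithinAt)
    fun t ht => ?_
  rw [interior_Iic] at ht
  rw [(hasDerivAt_requiredVar hr hκ i U T t).deriv]
  have hp := M.price_pos hκ i
  have h1 : 1 ≤ Real.exp (2 * (U - M.price i * t)) :=
    Real.one_le_exp (by have := mul_lt_mul_of_pos_left ht hp; linarith)
  have h2 := M.sigmaHatSq_le hκ i
  have h3 : M.sigmaHat ^ 2 * 1 ≤ M.sigmaHat ^ 2 * Real.exp (2 * (U - M.price i * t)) := by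
    gcongr
  have h4 : 0 ≤ M.sigmaHat ^ 2 * Real.exp (2 * (U - M.price i * t)) - M.sigmaHatSq i := by
    linarith
  have := hσ i
  have : 0 < M.price i * (M.sigmaHat ^ 2 * Real.exp (2 * (U - M.price i * t)) - M.sigmaHatSq i)
      + M.σ i ^ 2 := by positivity
  exact neg_lt_zero.2 (by positivity)

theorem hasDerivAt_requiredVar_time (hr : 0 < M.r) (hκ : ∀ i, 2 * M.κ i < M.r) (i : Fin n)
    (U T t : ℝ) : HasDerivAt (fun T => M.requiredVar i U T t) (Real.exp (-(2 * M.κ i * T)) *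
      (M.price i * (M.sigmaHat ^ 2 * Real.exp (2 * (U - M.price i * T)) - M.sigmaHatSq i))) T := by
  have h0 : M.r - M.κ i ≠ 0 := (M.r_sub_kappa_pos hr hκ i).ne'
  have h1 : HasDerivAt (fun T : ℝ => t - T) (-1) T := by
    simpa using (hasDerivAt_id' T).const_sub t
  have h2 := (hasDerivAt_expGap (M.κ i) (t - T)).comp T h1
  have h3 : HasDerivAt (fun T : ℝ => 2 * (U - M.price i * T) - 2 * M.κ i * (T - t))
      (-2 * M.price i - 2 * M.κ i) T := by
    have := (((hasDerivAt_id' T).const_mul (M.price i)).const_sub U).const_mul 2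
    refine (this.sub (((hasDerivAt_id' T).sub_const t).const_mul (2 * M.κ i))).congr_deriv ?_
    ring
  have h4 := (((h2.const_mul (M.sigmaHatSq i * M.price i)).add
    ((h3.exp.const_sub (Real.exp (2 * (U - M.price i * t)))).const_mul
    (M.sigmaHat ^ 2 * M.price i / (2 * (M.r - M.κ i))))).const_mul
      (Real.exp (-(2 * M.κ i * t)))).add_const (M.σ i ^ 2 * expGap (M.κ i) (-t))
  refine (h4.congr_of_eventuallyEq (Filter.Eventually.of_forall fun T => ?_)).congr_deriv ?_
  · simp only [requiredVar, η, late, Pi.add_apply, Function.comp_apply]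
    rw [show 2 * M.κ i * -t = -(2 * M.κ i * t) by ring, show -(T - t) = t - T by ring,
      show 2 * (U - M.price i * t) = 2 * (U - M.price i * T) + 2 * M.price i * (T - t) by ring,
      show 2 * (U - M.price i * T) - 2 * M.κ i * (T - t) =
        2 * (U - M.price i * T) + -2 * M.κ i * (T - t) by ring, Real.exp_add, Real.exp_add]
    ring
  · rw [show -(2 * M.κ i * T) = -(2 * M.κ i * t) + 2 * M.κ i * (t - T) by ring,
      show 2 * (U - M.price i * T) - 2 * M.κ i * (T - t) =
        2 * (U - M.price i * T) + 2 * M.κ i * (t - T) by ring, Real.exp_add, Real.exp_add,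
      show -2 * M.price i - 2 * M.κ i = -(2 * (M.r - M.κ i)) by rw [price]; ring]
    field_simp
    ring

/-- The required initial variance is monotone in the pair `(U, T)`. -/
theorem requiredVar_mono (hr : 0 < M.r) (hκ : ∀ i, 2 * M.κ i < M.r) (i : Fin n)
    {U₁ U₂ T₁ T₂ t : ℝ} (ht : t ≤ T₁) (hT : T₁ ≤ T₂) (hU : U₁ ≤ U₂) (hU₂ : M.price i * T₂ ≤ U₂) :
    M.requiredVar i U₁ T₁ t ≤ M.requiredVar i U₂ T₂ t := by
  have h1 : M.requiredVar i U₁ T₁ t ≤ M.requiredVar i U₂ T₁ t :=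
    M.eta_le_eta _ (M.late_le_late hr hκ i (sub_nonneg.2 ht) (by linarith))
  refine h1.trans ?_
  have h2 : MonotoneOn (fun T => M.requiredVar i U₂ T t) (Iic T₂) := by
    refine monotoneOn_of_deriv_nonneg (convex_Iic T₂)
      (fun T _ => (hasDerivAt_requiredVar_time hr hκ i U₂ T t).continuousAt.continuousWithinAt)
      (fun T _ =>
        (hasDerivAt_requiredVar_time hr hκ i U₂ T t).differentiableAt.differentiableWithinAt)
      fun T hT => ?_
    rw [interior_Iic] at hT
    rw [(hasDerivAt_requiredVar_time hr hκ i U₂ T t).deriv]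
    have hp := M.price_pos hκ i
    have h1 : 1 ≤ Real.exp (2 * (U₂ - M.price i * T)) :=
      Real.one_le_exp (by have := mul_lt_mul_of_pos_left hT hp; linarith)
    have h2 := M.sigmaHatSq_le hκ i
    have h3 : M.sigmaHat ^ 2 * 1 ≤ M.sigmaHat ^ 2 * Real.exp (2 * (U₂ - M.price i * T)) := by
      gcongr
    have h4 : 0 ≤ M.sigmaHat ^ 2 * Real.exp (2 * (U₂ - M.price i * T)) - M.sigmaHatSq i := by
      linarith
    positivity
  exact h2 hT (mem_Iic.2 le_rfl) hT

theorem requiredVar_lt (hr : 0 < M.r) (hσ : ∀ i, 0 < M.σ i) (hκ : ∀ i, 2 * M.κ i < M.r)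
    (i : Fin n) {U₁ U₂ T₁ T₂ t : ℝ} (ht : t < T₁) (hT : T₁ ≤ T₂) (hU : U₁ < U₂)
    (hU₂ : M.price i * T₂ ≤ U₂) : M.requiredVar i U₁ T₁ t < M.requiredVar i U₂ T₂ t :=
  (M.strictMono_eta i (-t)
    (M.late_lt_late hr hσ hκ i (sub_pos.2 ht) (by linarith))).trans_le
    (requiredVar_mono hr hκ i ht.le hT le_rfl hU₂)

theorem requiredVar_self_nonpos (i : Fin n) (U : ℝ) {T : ℝ} (hT : 0 ≤ T) :
    M.requiredVar i U T T ≤ 0 := by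
  have h : expGap (M.κ i) (-T) ≤ 0 := by
    simpa using (strictMono_expGap (M.κ i)).monotone (neg_nonpos.2 hT)
  simpa [requiredVar, η] using mul_nonpos_of_nonneg_of_nonpos (sq_nonneg (M.σ i)) h

theorem requiredVar_self_neg (hσ : ∀ i, 0 < M.σ i) (i : Fin n) (U : ℝ) {T : ℝ} (hT : 0 < T) :
    M.requiredVar i U T T < 0 := by
  have h : expGap (M.κ i) (-T) < 0 := by
    simpa using strictMono_expGap (M.κ i) (neg_lt_zero.2 hT)
  simpa [requiredVar, η] using mul_neg_of_pos_of_neg (pow_pos (hσ i) 2) h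

variable (M) in
theorem continuous_requiredVar (i : Fin n) :
    Continuous fun x : ℝ × ℝ × ℝ => M.requiredVar i x.1 x.2.1 x.2.2 := by
  unfold requiredVar η late
  have := continuous_expGap (M.κ i)
  fun_prop

/-! ### One backward step of the schedule -/

variable (M) in
/-- `t` is the time at which component `i` starts to be partially revealed, given that it is fully
revealed at `T`, that the logarithmic bias extrapolated to time `0` is `U`, and that its initial
variance is used up unless partial disclosure starts at time `0`. -/
structure IsStart (i : Fin n) (U T t : ℝ) : Prop where
  nonneg : 0 ≤ t
  le : t ≤ T
  var_le : M.requiredVar i U T t ≤ M.σ₀ i ^ 2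
  tight : t = 0 ∨ M.requiredVar i U T t = M.σ₀ i ^ 2

theorem exists_isStart (hr : 0 < M.r) (hκ : ∀ i, 2 * M.κ i < M.r) (i : Fin n) (U : ℝ) {T : ℝ}
    (hT : 0 ≤ T) : ∃ t, M.IsStart i U T t := by
  by_cases h0 : M.requiredVar i U T 0 ≤ M.σ₀ i ^ 2
  · exact ⟨0, le_rfl, hT, h0, Or.inl rfl⟩
  · have hc : ContinuousOn (M.requiredVar i U T) (Icc 0 T) := fun t _ =>
      (hasDerivAt_requiredVar hr hκ i U T t).continuousAt.continuousWithinAt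
    obtain ⟨t, ht, hteq⟩ := intermediate_value_Icc' hT hc
      ⟨(requiredVar_self_nonpos i U hT).trans (sq_nonneg (M.σ₀ i)), (not_le.1 h0).le⟩
    exact ⟨t, ht.1, ht.2, hteq.le, Or.inr hteq⟩

/-- A later full disclosure and a larger bias delay the start of partial disclosure. -/
theorem IsStart.mono (hr : 0 < M.r) (hσ : ∀ i, 0 < M.σ i) (hκ : ∀ i, 2 * M.κ i < M.r)
    {i : Fin n} {U₁ U₂ T₁ T₂ t₁ t₂ : ℝ} (h₁ : M.IsStart i U₁ T₁ t₁) (h₂ : M.IsStart i U₂ T₂ t₂)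
    (hT : T₁ ≤ T₂) (hU : U₁ ≤ U₂) (hU₁ : M.price i * T₁ ≤ U₁) (hU₂ : M.price i * T₂ ≤ U₂) :
    t₁ ≤ t₂ := by
  by_contra! hlt
  have h3 : M.requiredVar i U₁ T₁ t₁ = M.σ₀ i ^ 2 :=
    h₁.tight.resolve_left (h₂.nonneg.trans_lt hlt).ne'
  have h4 : M.requiredVar i U₁ T₁ t₂ ≤ M.requiredVar i U₂ T₂ t₂ :=
    requiredVar_mono hr hκ i (hlt.le.trans h₁.le) hT hU hU₂
  have h5 : M.requiredVar i U₁ T₁ t₁ < M.requiredVar i U₁ T₁ t₂ :=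
    requiredVar_strictAntiOn hr hσ hκ i hU₁ (hlt.le.trans h₁.le) h₁.le hlt
  linarith [h₂.var_le]

theorem IsStart.unique (hr : 0 < M.r) (hσ : ∀ i, 0 < M.σ i) (hκ : ∀ i, 2 * M.κ i < M.r)
    {i : Fin n} {U T t₁ t₂ : ℝ} (h₁ : M.IsStart i U T t₁) (h₂ : M.IsStart i U T t₂)
    (hU : M.price i * T ≤ U) : t₁ = t₂ :=
  le_antisymm (h₁.mono hr hσ hκ h₂ le_rfl le_rfl hU hU)
    (h₂.mono hr hσ hκ h₁ le_rfl le_rfl hU hU)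

theorem IsStart.lt (hσ : ∀ i, 0 < M.σ i) {i : Fin n} {U T t : ℝ} (h : M.IsStart i U T t)
    (hT : 0 < T) : t < T := by
  refine h.le.lt_of_ne fun hne => ?_
  subst hne
  have h1 := h.tight.resolve_left hT.ne'
  have h2 := requiredVar_self_neg hσ i U hT
  nlinarith [sq_nonneg (M.σ₀ i)]

/-- The start of partial disclosure depends continuously on the time of full disclosure and on the
bias. -/
theorem IsStart.tendsto (hr : 0 < M.r) (hσ : ∀ i, 0 < M.σ i) (hκ : ∀ i, 2 * M.κ i < M.r)
    {i : Fin n} {X : Type*} {l : Filter X} {U T t : X → ℝ} {U₀ T₀ t₀ : ℝ}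
    (h : ∀ᶠ x in l, M.IsStart i (U x) (T x) (t x) ∧ M.price i * T x ≤ U x)
    (h₀ : M.IsStart i U₀ T₀ t₀) (hU₀ : M.price i * T₀ ≤ U₀)
    (hU : Filter.Tendsto U l (nhds U₀)) (hT : Filter.Tendsto T l (nhds T₀)) :
    Filter.Tendsto t l (nhds t₀) := by
  have hv : ∀ a, Filter.Tendsto (fun x => M.requiredVar i (U x) (T x) a) l
      (nhds (M.requiredVar i U₀ T₀ a)) := fun a => by
    have h1 : Filter.Tendsto (fun x => (U x, T x, a)) l (nhds (U₀, T₀, a)) :=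
      hU.prodMk_nhds (hT.prodMk_nhds tendsto_const_nhds)
    have h2 := (M.continuous_requiredVar i).tendsto (U₀, T₀, a)
    simpa only [Function.comp_def] using h2.comp h1
  refine tendsto_order.2 ⟨fun a ha => ?_, fun a ha => ?_⟩
  · rcases lt_or_ge a 0 with ha0 | ha0
    · filter_upwards [h] with x hx using ha0.trans_le hx.1.nonneg
    have h1 : M.requiredVar i U₀ T₀ t₀ = M.σ₀ i ^ 2 :=
      h₀.tight.resolve_left (ha0.trans_lt ha).ne'
    have hat : a < T₀ := ha.trans_le h₀.le
    have h2 : M.σ₀ i ^ 2 < M.requiredVar i U₀ T₀ a := by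
      rw [← h1]
      exact requiredVar_strictAntiOn hr hσ hκ i hU₀ hat.le h₀.le ha
    have e1 := (hv a).eventually_const_lt h2
    have e2 := hT.eventually_const_lt hat
    filter_upwards [h, e1, e2] with x hx hx1 hx2
    by_contra! hle
    have h3 := (requiredVar_strictAntiOn hr hσ hκ i hx.2).antitoneOn
      (mem_Iic.2 hx.1.le) (mem_Iic.2 hx2.le) hle
    linarith [hx.1.var_le]
  · rcases lt_or_ge T₀ a with haT | haT
    · filter_upwards [h, hT.eventually_lt_const haT] with x hx hx1 using hx.1.le.trans_lt hx1
    have h2 : M.requiredVar i U₀ T₀ a < M.σ₀ i ^ 2 :=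
      (requiredVar_strictAntiOn hr hσ hκ i hU₀ h₀.le haT ha).trans_le h₀.var_le
    have e1 := (hv a).eventually_lt_const h2
    filter_upwards [h, e1] with x hx hx1
    by_contra! hle
    have h3 := (requiredVar_strictAntiOn hr hσ hκ i hx.2).antitoneOn
      (mem_Iic.2 (hle.trans hx.1.le)) (mem_Iic.2 hx.1.le) hle
    have h4 := hx.1.tight.resolve_left ((h₀.nonneg.trans_lt ha).trans_le hle).ne'
    linarith

/-! ### Existence and uniqueness of the schedule -/

variable (M) in
/-- The start of partial disclosure of component `i`, as a function of the logarithmic bias `U`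
extrapolated to time `0` and of the full-disclosure time `T`. -/
def start (i : Fin n) (U T : ℝ) : ℝ := Classical.epsilon (M.IsStart i U T)

theorem isStart_start (hr : 0 < M.r) (hκ : ∀ i, 2 * M.κ i < M.r) (i : Fin n) (U : ℝ) {T : ℝ}
    (hT : 0 ≤ T) : M.IsStart i U T (M.start i U T) :=
  Classical.epsilon_spec (exists_isStart hr hκ i U hT)

variable (M) in
/-- The pair of the `j`-th full-disclosure time and the logarithm of the bias over `σ̂` at that
time, computed backward from the last full-disclosure time `S`. -/
def stage (S : ℝ) (j : Fin (n + 1)) : ℝ × ℝ :=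
  Fin.reverseInduction (motive := fun _ => ℝ × ℝ) (S, 0) (fun i x =>
    (M.start i (x.2 + M.price i * x.1) x.1,
      x.2 + M.price i * (x.1 - M.start i (x.2 + M.price i * x.1) x.1))) j

@[simp] theorem stage_last (S : ℝ) : M.stage S (Fin.last n) = (S, 0) := by
  simp [stage]

theorem stage_castSucc (S : ℝ) (i : Fin n) : M.stage S i.castSucc =
    (M.start i ((M.stage S i.succ).2 + M.price i * (M.stage S i.succ).1) (M.stage S i.succ).1,
      (M.stage S i.succ).2 + M.price i * ((M.stage S i.succ).1 -
      M.start i ((M.stage S i.succ).2 + M.price i * (M.stage S i.succ).1)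
        (M.stage S i.succ).1)) := by
  rw [stage, Fin.reverseInduction_castSucc]
  rfl

theorem stage_castSucc_snd (S : ℝ) (i : Fin n) : (M.stage S i.castSucc).2 =
    (M.stage S i.succ).2 + M.price i * ((M.stage S i.succ).1 - (M.stage S i.castSucc).1) := by
  rw [stage_castSucc]

theorem stage_nonneg (hr : 0 < M.r) (hκ : ∀ i, 2 * M.κ i < M.r) {S : ℝ} (hS : 0 ≤ S)
    (j : Fin (n + 1)) : 0 ≤ (M.stage S j).1 ∧ 0 ≤ (M.stage S j).2 := by
  induction j using Fin.reverseInduction with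
  | last => simpa using hS
  | cast i ih =>
    have h := isStart_start hr hκ i ((M.stage S i.succ).2 + M.price i * (M.stage S i.succ).1) ih.1
    have hp := M.price_pos hκ i
    rw [stage_castSucc]
    exact ⟨h.nonneg, add_nonneg ih.2 (mul_nonneg hp.le (sub_nonneg.2 h.le))⟩

theorem isStart_stage (hr : 0 < M.r) (hκ : ∀ i, 2 * M.κ i < M.r) {S : ℝ} (hS : 0 ≤ S)
    (i : Fin n) : M.IsStart i ((M.stage S i.succ).2 + M.price i * (M.stage S i.succ).1)
      (M.stage S i.succ).1 (M.stage S i.castSucc).1 := by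
  rw [stage_castSucc]
  exact isStart_start hr hκ i _ (stage_nonneg hr hκ hS _).1

theorem price_mul_stage_le (hr : 0 < M.r) (hκ : ∀ i, 2 * M.κ i < M.r) {S : ℝ} (hS : 0 ≤ S)
    (i : Fin n) : M.price i * (M.stage S i.succ).1 ≤
      (M.stage S i.succ).2 + M.price i * (M.stage S i.succ).1 := by
  linarith [(stage_nonneg hr hκ hS i.succ).2]

theorem stage_zero (hr : 0 < M.r) (hκ : ∀ i, 2 * M.κ i < M.r) (j : Fin (n + 1)) :
    M.stage 0 j = (0, 0) := by
  induction j using Fin.reverseInduction with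
  | last => simp
  | cast i ih =>
    have h := isStart_stage hr hκ le_rfl i
    rw [ih] at h
    have h0 : (M.stage 0 i.castSucc).1 = 0 := le_antisymm h.le h.nonneg
    refine Prod.ext h0 ?_
    rw [stage_castSucc_snd, h0, ih]
    simp

/-- Postponing the last full-disclosure time postpones all of them and raises the bias,
extrapolated back at any rate that is at least as large as the remaining prices. This is where the
order of the components matters. -/
theorem stage_lt (hr : 0 < M.r) (hσ : ∀ i, 0 < M.σ i) (hκ : ∀ i, 2 * M.κ i < M.r)
    (hmono : Monotone M.κ) {S₁ S₂ : ℝ} (h₁ : 0 ≤ S₁) (h : S₁ < S₂) (j : Fin (n + 1)) :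
    (M.stage S₁ j).1 ≤ (M.stage S₂ j).1 ∧
      ∀ q, 0 < q → (∀ i : Fin n, j ≤ i.castSucc → M.price i ≤ q) →
        (M.stage S₁ j).2 + q * (M.stage S₁ j).1 < (M.stage S₂ j).2 + q * (M.stage S₂ j).1 := by
  have h₂ := h₁.trans h.le
  induction j using Fin.reverseInduction with
  | last =>
    refine ⟨by simpa using h.le, fun q hq _ => ?_⟩
    simpa using mul_lt_mul_of_pos_left h hq
  | cast i ih =>
    obtain ⟨ih1, ih2⟩ := ih
    have hU := ih2 (M.price i) (M.price_pos hκ i) fun k hk =>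
      M.antitone_price hmono (Fin.succ_le_castSucc_iff.1 hk).le
    have hT := (isStart_stage hr hκ h₁ i).mono hr hσ hκ (isStart_stage hr hκ h₂ i) ih1 hU.le
      (price_mul_stage_le hr hκ h₁ i) (price_mul_stage_le hr hκ h₂ i)
    refine ⟨hT, fun q _ hqp => ?_⟩
    have hq := mul_le_mul_of_nonneg_left hT (sub_nonneg.2 (hqp i le_rfl))
    rw [stage_castSucc_snd, stage_castSucc_snd]
    linarith

theorem mul_le_stage (hr : 0 < M.r) (hκ : ∀ i, 2 * M.κ i < M.r) {S q : ℝ} (hS : 0 ≤ S)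
    (hq : ∀ i, q ≤ M.price i) (j : Fin (n + 1)) :
    q * S ≤ (M.stage S j).2 + q * (M.stage S j).1 := by
  induction j using Fin.reverseInduction with
  | last => simp
  | cast i ih =>
    have h := (isStart_stage hr hκ hS i).le
    have := mul_le_mul_of_nonneg_right (hq i) (sub_nonneg.2 h)
    rw [stage_castSucc_snd]
    linarith

theorem continuousOn_stage (hr : 0 < M.r) (hσ : ∀ i, 0 < M.σ i) (hκ : ∀ i, 2 * M.κ i < M.r)
    (j : Fin (n + 1)) : ContinuousOn (fun S => M.stage S j) (Ici 0) := by
  induction j using Fin.reverseInduction with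
  | last =>
    simp only [stage_last]
    fun_prop
  | cast i ih =>
    have hT := ih.fst
    have hU := ih.snd.add (hT.const_mul (M.price i))
    have ht : ContinuousOn (fun S => (M.stage S i.castSucc).1) (Ici 0) := fun S hS =>
      IsStart.tendsto hr hσ hκ
        (by
          filter_upwards [self_mem_nhdsWithin] with S' hS'
          exact ⟨isStart_stage hr hκ hS' i, price_mul_stage_le hr hκ hS' i⟩)
        (isStart_stage hr hκ hS i) (price_mul_stage_le hr hκ hS i) (hU S hS) (hT S hS)
    refine ht.prodMk (f := fun S => (M.stage S i.castSucc).1)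
      (g := fun S => (M.stage S i.castSucc).2) ?_
    simp only [stage_castSucc_snd]
    exact ih.snd.add ((hT.sub ht).const_mul _)

variable (M) in
/-- The logarithm of the bias over `σ̂` at the `j`-th full-disclosure time. -/
def tailLog (T : Fin (n + 1) → ℝ) (j : Fin (n + 1)) : ℝ :=
  ∑ i : Fin n with j ≤ i.castSucc, M.price i * (T i.succ - T i.castSucc)

@[simp] theorem tailLog_last (T : Fin (n + 1) → ℝ) : M.tailLog T (Fin.last n) = 0 := by
  refine Finset.sum_eq_zero fun i hi => ?_
  have := (Finset.mem_filter.1 hi).2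
  exact absurd i.castSucc_lt_last (not_lt.2 this)

theorem tailLog_succ (T : Fin (n + 1) → ℝ) (i : Fin n) : M.tailLog T i.succ = M.tauSucc T i := by
  refine Finset.sum_congr ?_ fun _ _ => rfl
  ext k
  simp [Fin.succ_le_castSucc_iff]

theorem tailLog_castSucc (T : Fin (n + 1) → ℝ) (i : Fin n) : M.tailLog T i.castSucc =
    M.tauSucc T i + M.price i * (T i.succ - T i.castSucc) := by
  have : (Finset.univ.filter fun k : Fin n => i.castSucc ≤ k.castSucc) =
      insert i (Finset.Ioi i) := by
    ext k
    simp [le_iff_eq_or_lt]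
  rw [tailLog, this, Finset.sum_insert (by simp), tauSucc, add_comm]

variable (M) in
/-- The logarithm of the bias over `σ̂` before the `i`-th full-disclosure time, extrapolated to
time `0` at the rate `price i`. -/
def logBiasZero (T : Fin (n + 1) → ℝ) (i : Fin n) : ℝ := M.tauSucc T i + M.price i * T i.succ

theorem eq_stage (hr : 0 < M.r) (hσ : ∀ i, 0 < M.σ i) (hκ : ∀ i, 2 * M.κ i < M.r)
    {T : Fin (n + 1) → ℝ} (h0 : 0 ≤ T (Fin.last n))
    (h : ∀ i, M.IsStart i (M.logBiasZero T i) (T i.succ) (T i.castSucc)) (j : Fin (n + 1)) :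
    M.stage (T (Fin.last n)) j = (T j, M.tailLog T j) := by
  induction j using Fin.reverseInduction with
  | last => simp
  | cast i ih =>
    have h1 := isStart_stage hr hκ h0 i
    have h2 := price_mul_stage_le hr hκ h0 i
    rw [ih, tailLog_succ] at h1 h2
    have h3 := h1.unique hr hσ hκ (h i) h2
    refine Prod.ext h3 ?_
    rw [stage_castSucc_snd, ih, tailLog_castSucc, tailLog_succ, h3]

theorem tailLog_stage (S : ℝ) (j : Fin (n + 1)) :
    M.tailLog (fun j => (M.stage S j).1) j = (M.stage S j).2 := by
  induction j using Fin.reverseInduction with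
  | last => simp
  | cast i ih => rw [tailLog_castSucc, ← tailLog_succ, ih, stage_castSucc_snd]

theorem IsSchedule.monotone {c : Fin (n + 1)} {T : Fin (n + 1) → ℝ} (h : M.IsSchedule c T) :
    Monotone T := by
  have hlow : ∀ j : Fin (n + 1), j ≤ c → T j = 0 := by
    intro j
    induction j using Fin.induction with
    | zero => exact fun _ => h.zero
    | succ i _ => exact fun hi => h.before i (Fin.castSucc_lt_succ.trans_le hi)
  refine Fin.monotone_iff_le_succ.2 fun i => ?_
  rcases lt_or_ge i.castSucc c with hi | hi
  · rw [h.before i hi, hlow _ hi.le]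
  · exact (h.strict i hi).le

theorem IsSchedule.nonneg {c : Fin (n + 1)} {T : Fin (n + 1) → ℝ} (h : M.IsSchedule c T)
    (j : Fin (n + 1)) : 0 ≤ T j := by
  rw [← h.zero]
  exact h.monotone (Fin.zero_le _)

theorem IsSchedule.eq_zero {c : Fin (n + 1)} {T : Fin (n + 1) → ℝ} (h : M.IsSchedule c T)
    {j : Fin (n + 1)} (hj : j ≤ c) : T j = 0 := by
  induction j using Fin.induction with
  | zero => exact h.zero
  | succ i _ => exact h.before i (Fin.castSucc_lt_succ.trans_le hj)

theorem IsSchedule.lt_iff {c : Fin (n + 1)} {T : Fin (n + 1) → ℝ} (h : M.IsSchedule c T)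
    (i : Fin n) : i.castSucc < c ↔ T i.succ = 0 := by
  refine ⟨h.before i, fun h0 => ?_⟩
  by_contra! hc
  have := h.strict i hc
  rw [h0] at this
  exact absurd this (not_lt.2 (h.nonneg _))

theorem varPath_zero {c : Fin (n + 1)} {T : Fin (n + 1) → ℝ} (hT : ∀ j, 0 ≤ T j)
    (hle : ∀ i : Fin n, T i.castSucc ≤ T i.succ)
    (hc : ∀ i : Fin n, i.castSucc < c → T i.succ = 0) (i : Fin n) :
    M.varPath c T 0 i =
      M.requiredVar i (M.logBiasZero T i) (T i.succ) (T i.castSucc) := by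
  have hU : M.logBiasZero T i - M.price i * T i.succ = M.tauSucc T i := by
    simp [logBiasZero]
  have hmax : ∀ t, t ≤ T i.succ →
      M.varLate T i t = M.late i (M.tauSucc T i) (T i.succ - t) := fun t ht => by
    rw [varLate, late, max_eq_left (sub_nonneg.2 ht)]
  unfold varPath requiredVar
  rw [hU]
  split_ifs with h1 h2
  · have h3 := hc i h1
    have h4 : T i.castSucc = 0 := le_antisymm (h3 ▸ hle i) (hT _)
    simp [h3, h4]
  · have h4 : T i.castSucc = 0 := le_antisymm h2 (hT _)
    rw [hmax _ (hT _), h4]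
    simp
  · rw [hmax _ (hle i), zero_sub]

theorem norm_biasPath {c : Fin (n + 1)} {T : Fin (n + 1) → ℝ} (hβ : M.β ≠ 0) (t : ℝ) :
    ‖M.biasPath c T t‖ = M.sigmaHat * Real.exp (∑ i : Fin n with c ≤ i.castSucc,
      M.price i * max (T i.succ - max t (T i.castSucc)) 0) := by
  have h1 : ‖M.β‖ ≠ 0 := norm_ne_zero_iff.2 hβ
  have h2 : 0 ≤ M.sigmaHat := Real.sqrt_nonneg _
  rw [biasPath, norm_smul, norm_smul, norm_inv, norm_norm, inv_mul_cancel₀ h1, mul_one,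
    Real.norm_of_nonneg (by positivity)]

/-- The exponent of the bias path at time `t`, with all components. -/
theorem sum_filter_eq {c : Fin (n + 1)} {T : Fin (n + 1) → ℝ}
    (hc : ∀ i : Fin n, i.castSucc < c → T i.succ = 0) {t : ℝ} (ht : 0 ≤ t) :
    (∑ i : Fin n with c ≤ i.castSucc, M.price i * max (T i.succ - max t (T i.castSucc)) 0) =
      ∑ i, M.price i * max (T i.succ - max t (T i.castSucc)) 0 := by
  refine Finset.sum_filter_of_ne fun i _ hne => ?_
  by_contra! hi
  apply hne
  rw [hc i hi, max_eq_right, mul_zero]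
  have := le_max_left t (T i.castSucc)
  linarith

theorem norm_biasPath_zero {c : Fin (n + 1)} {T : Fin (n + 1) → ℝ} (hβ : M.β ≠ 0)
    (hT : ∀ j, 0 ≤ T j) (hle : ∀ i : Fin n, T i.castSucc ≤ T i.succ)
    (hc : ∀ i : Fin n, i.castSucc < c → T i.succ = 0) :
    ‖M.biasPath c T 0‖ = M.sigmaHat * Real.exp (M.tailLog T 0) := by
  rw [norm_biasPath hβ, sum_filter_eq hc le_rfl, tailLog]
  simp only [Fin.zero_le, Finset.filter_true]
  congr 3 with i
  rw [max_eq_right (hT _), max_eq_left (sub_nonneg.2 (hle i))]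

theorem IsSchedule.varPath_zero {c : Fin (n + 1)} {T : Fin (n + 1) → ℝ} (h : M.IsSchedule c T)
    (i : Fin n) : M.varPath c T 0 i =
      M.requiredVar i (M.logBiasZero T i) (T i.succ) (T i.castSucc) :=
  OUModel.varPath_zero h.nonneg (fun _ => h.monotone Fin.castSucc_lt_succ.le) h.before i

theorem IsSchedule.isStart {c : Fin (n + 1)} {T : Fin (n + 1) → ℝ} (h : M.IsSchedule c T)
    (i : Fin n) : M.IsStart i (M.logBiasZero T i) (T i.succ) (T i.castSucc) where
  nonneg := h.nonneg _
  le := h.monotone Fin.castSucc_lt_succ.le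
  var_le := by
    rw [← h.varPath_zero]
    rcases lt_trichotomy i.castSucc c with hi | hi | hi
    · rw [varPath, if_pos hi]
      exact sq_nonneg _
    · exact h.critical i hi
    · exact (h.later i hi).le
  tight := by
    rcases le_or_gt i.castSucc c with hi | hi
    · exact Or.inl (h.eq_zero hi)
    · rw [← h.varPath_zero]
      exact Or.inr (h.later i hi)

/-- A critical component has uncertainty to disclose. -/
theorem IsSchedule.sigma₀_ne_zero (hr : 0 < M.r) (hσ : ∀ i, 0 < M.σ i)
    (hκ : ∀ i, 2 * M.κ i < M.r) {c : Fin (n + 1)} {T : Fin (n + 1) → ℝ} (h : M.IsSchedule c T)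
    {i : Fin n} (hi : i.castSucc = c) : M.σ₀ i ≠ 0 := fun h0 => by
  have h1 := h.critical i hi
  have h2 : T i.castSucc = 0 := h.eq_zero hi.le
  have h3 := h.strict i hi.ge
  have hτ : 0 ≤ M.tauSucc T i := Finset.sum_nonneg fun j _ => mul_nonneg (M.price_pos hκ j).le
    (sub_nonneg.2 (h.monotone Fin.castSucc_lt_succ.le))
  rw [h2] at h3
  rw [h.varPath_zero, h0, requiredVar, h2] at h1
  simp only [neg_zero, eta_zero, sub_zero, logBiasZero, add_sub_cancel_right] at h1
  have := late_pos M hr hσ hκ i hτ h3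
  norm_num at h1
  linarith

theorem IsSchedule.eq_last_iff (hr : 0 < M.r) (hσ : ∀ i, 0 < M.σ i)
    (hκ : ∀ i, 2 * M.κ i < M.r) (hβ : M.sigmaHat < ‖M.β‖) {c : Fin (n + 1)}
    {T : Fin (n + 1) → ℝ} (h : M.IsSchedule c T) : c = Fin.last n ↔ ∀ i, M.σ₀ i = 0 := by
  have hβ0 : M.β ≠ 0 := norm_pos_iff.1 ((Real.sqrt_nonneg _).trans_lt hβ)
  constructor
  · rintro rfl i
    have hT : ∀ j, T j = 0 := fun j => h.eq_zero (Fin.le_last j)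
    rcases h.tight with ht | ht
    · rw [norm_biasPath_zero hβ0 h.nonneg (fun i => h.monotone Fin.castSucc_lt_succ.le) h.before]
        at ht
      simp only [tailLog, hT, sub_self, mul_zero, Finset.sum_const_zero, Real.exp_zero,
        mul_one] at ht
      exact absurd ht hβ.ne
    · have := ht i
      rw [varPath, if_pos i.castSucc_lt_last] at this
      simpa using this.symm
  · intro h0
    by_contra hc
    obtain ⟨i, rfl⟩ := Fin.exists_castSucc_eq.2 hc
    exact h.sigma₀_ne_zero hr hσ hκ rfl (h0 i)

theorem IsSchedule.critical_unique {c c' : Fin (n + 1)} {T : Fin (n + 1) → ℝ}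
    (h : M.IsSchedule c T) (h' : M.IsSchedule c' T) : c ≤ c' := by
  by_contra! hlt
  obtain ⟨i, rfl⟩ := Fin.exists_castSucc_eq.2 (hlt.trans_le (Fin.le_last c)).ne
  exact lt_irrefl _ ((h'.lt_iff i).2 ((h.lt_iff i).1 hlt))

/-- Two schedules have the same last full-disclosure time, because a later one would violate the
condition that is tight for the earlier one. -/
theorem IsSchedule.last_le (hr : 0 < M.r) (hσ : ∀ i, 0 < M.σ i)
    (hκ : ∀ i, 2 * M.κ i < M.r) (hmono : Monotone M.κ) (hβ : M.sigmaHat < ‖M.β‖)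
    {c c' : Fin (n + 1)} {T T' : Fin (n + 1) → ℝ}
    (h : M.IsSchedule c T) (h' : M.IsSchedule c' T') : T' (Fin.last n) ≤ T (Fin.last n) := by
  have hβ0 : M.β ≠ 0 := norm_pos_iff.1 ((Real.sqrt_nonneg _).trans_lt hβ)
  by_contra! hlt
  have hs := eq_stage hr hσ hκ (h.nonneg _) h.isStart
  have hs' := eq_stage hr hσ hκ (h'.nonneg _) h'.isStart
  have hcmp := stage_lt hr hσ hκ hmono (h.nonneg _) hlt
  have hne : c ≠ Fin.last n := fun hc => by
    have hc' : c' = Fin.last n := (h'.eq_last_iff hr hσ hκ hβ).2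
      ((h.eq_last_iff hr hσ hκ hβ).1 hc)
    rw [h'.eq_zero (j := Fin.last n) hc'.ge] at hlt
    exact absurd hlt (not_lt.2 (h.nonneg _))
  obtain ⟨k, rfl⟩ := Fin.exists_castSucc_eq.2 hne
  rcases h.tight with ht | ht
  · -- The later schedule has a larger initial bias.
    have hle := h'.bias_le
    rw [← ht, norm_biasPath_zero hβ0 h.nonneg (fun i => h.monotone Fin.castSucc_lt_succ.le)
      h.before, norm_biasPath_zero hβ0 h'.nonneg
      (fun i => h'.monotone Fin.castSucc_lt_succ.le) h'.before] at hle
    have hP : ∀ i, M.price i ≤ ∑ i, M.price i := fun i =>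
      Finset.single_le_sum (fun i _ => (M.price_pos hκ i).le) (Finset.mem_univ i)
    have h1 := (hcmp 0).2 (∑ i, M.price i) ((M.price_pos hκ k).trans_le (hP k)) fun i _ => hP i
    rw [hs, hs'] at h1
    simp only [h.zero, h'.zero, mul_zero, add_zero] at h1
    have hs0 := M.sigmaHat_pos hσ hκ k
    exact absurd hle (not_le.2 (mul_lt_mul_of_pos_left (Real.exp_lt_exp.2 h1) hs0))
  · -- The later schedule requires more initial variance of the critical component.
    have hk := ht k
    have hT0 : T k.castSucc = 0 := h.eq_zero le_rfl
    have hpos := h.strict k le_rfl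
    have h0 : T' k.castSucc = 0 := by
      refine h'.eq_zero ?_
      by_contra! hc
      obtain ⟨i, rfl⟩ := Fin.exists_castSucc_eq.2 (hc.trans_le (Fin.le_last _)).ne
      have h2 := ht i
      rw [varPath, if_pos hc] at h2
      exact h'.sigma₀_ne_zero hr hσ hκ rfl (by simpa using h2.symm)
    have h3 := (h'.isStart k).var_le
    rw [h.varPath_zero, hT0] at hk
    rw [h0] at h3
    rw [hT0] at hpos
    have h4 := hcmp k.succ
    rw [hs, hs'] at h4
    have h5 := h4.2 (M.price k) (M.price_pos hκ k) fun i hi =>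
      M.antitone_price hmono (Fin.succ_le_castSucc_iff.1 hi).le
    have h6 := price_mul_stage_le hr hκ (h'.nonneg (Fin.last n)) k
    rw [hs'] at h6
    simp only [tailLog_succ] at h5 h6
    have h7 := requiredVar_lt hr hσ hκ k hpos h4.1 h5 h6
    simp only [logBiasZero] at hk h3
    linarith

theorem exists_isSchedule (hr : 0 < M.r) (hσ : ∀ i, 0 < M.σ i)
    (hκ : ∀ i, 2 * M.κ i < M.r) (hβ : M.sigmaHat < ‖M.β‖) :
    ∃ c T, M.IsSchedule c T := by
  have hβ0 : M.β ≠ 0 := norm_pos_iff.1 ((Real.sqrt_nonneg _).trans_lt hβ)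
  by_cases hz : ∀ i, M.σ₀ i = 0
  · have hv : ∀ i, M.varPath (Fin.last n) (fun _ => 0) 0 i = 0 := fun i => by
      rw [varPath, if_pos i.castSucc_lt_last]
    refine ⟨Fin.last n, fun _ => 0, rfl, fun _ _ => rfl,
      fun i hi => absurd i.castSucc_lt_last (not_lt.2 hi), ?_, ?_, ?_, ?_⟩
    · rw [norm_biasPath_zero hβ0 (fun _ => le_rfl) (fun _ => le_rfl) fun _ _ => rfl]
      simpa [tailLog] using hβ.le
    · exact fun i _ => (hv i).le.trans (sq_nonneg _)
    · exact fun i _ => by rw [hv, hz, sq, mul_zero]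
    · exact Or.inr fun i => by rw [hv, hz, sq, mul_zero]
  -- `k` is the first component with initial uncertainty.
  obtain ⟨k, hk, hkmin⟩ : ∃ k, M.σ₀ k ≠ 0 ∧ ∀ i < k, M.σ₀ i = 0 := by
    push Not at hz
    obtain ⟨k, hk⟩ := WellFounded.has_min (wellFounded_lt (α := Fin n)) {i | M.σ₀ i ≠ 0} hz
    exact ⟨k, hk.1, fun i hi => by_contra fun h => hk.2 i h hi⟩
  have hs0 := M.sigmaHat_pos hσ hκ k
  have hβpos : 0 < ‖M.β‖ := hs0.trans hβ
  have hk2 : 0 < M.σ₀ k ^ 2 := by positivity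
  set L : ℝ := Real.log (‖M.β‖ / M.sigmaHat) with hL
  have hLpos : 0 < L := Real.log_pos ((one_lt_div hs0).2 hβ)
  set P : ℝ := ∑ i, M.price i
  have hPle : ∀ i, M.price i ≤ P := fun i =>
    Finset.single_le_sum (fun i _ => (M.price_pos hκ i).le) (Finset.mem_univ i)
  obtain ⟨i₁, -, hi₁⟩ := Finset.exists_min_image Finset.univ M.price ⟨k, Finset.mem_univ k⟩
  set q := M.price i₁
  have hqpos : 0 < q := M.price_pos hκ i₁
  -- `H` is the larger one of the excesses of the initial bias and of the initial variance of `k`.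
  let H : ℝ → ℝ := fun S => max ((M.stage S 0).2 + P * (M.stage S 0).1 - L)
    (M.requiredVar k ((M.stage S k.succ).2 + M.price k * (M.stage S k.succ).1)
      (M.stage S k.succ).1 0 - M.σ₀ k ^ 2)
  have hHc : ContinuousOn H (Ici 0) := by
    have c0 := continuousOn_stage hr hσ hκ (0 : Fin (n + 1))
    have ck := continuousOn_stage hr hσ hκ k.succ
    have h1 : ContinuousOn (fun S => ((M.stage S k.succ).2 + M.price k * (M.stage S k.succ).1,
        (M.stage S k.succ).1, (0 : ℝ))) (Ici 0) :=
      (ck.snd.add (ck.fst.const_mul (M.price k))).prodMk (ck.fst.prodMk continuousOn_const)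
    have h2 := (M.continuous_requiredVar k).comp_continuousOn h1
    simp only [Function.comp_def] at h2
    have h3 : ContinuousOn (fun S => (M.stage S 0).2 + P * (M.stage S 0).1 - L) (Ici 0) :=
      (c0.snd.add (c0.fst.const_mul P)).sub continuousOn_const
    exact h3.sup (h2.sub continuousOn_const)
  have hH0 : H 0 < 0 := by
    refine max_lt ?_ ?_
    · rw [stage_zero hr hκ]
      simpa using hLpos
    · rw [stage_zero hr hκ]
      simpa [requiredVar] using hk2
  have hHL : 0 ≤ H (L / q) := by
    refine le_trans (sub_nonneg.2 ?_) (le_max_left _ _)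
    have hS : 0 ≤ L / q := (div_pos hLpos hqpos).le
    have h1 := mul_le_stage hr hκ hS (fun i => hi₁ i (Finset.mem_univ i)) 0
    have h2 := mul_le_mul_of_nonneg_right (hPle i₁) (stage_nonneg hr hκ hS 0).1
    rw [mul_div_cancel₀ _ hqpos.ne'] at h1
    linarith
  obtain ⟨S, hS, hSH⟩ := intermediate_value_Icc (div_pos hLpos hqpos).le
    (hHc.mono Icc_subset_Ici_self) ⟨hH0.le, hHL⟩
  have hSpos : 0 < S := hS.1.lt_of_ne fun h => by
    rw [← h] at hSH
    exact hH0.ne hSH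
  set T : Fin (n + 1) → ℝ := fun j => (M.stage S j).1 with hTdef
  have hT : ∀ j, 0 ≤ T j := fun j => (stage_nonneg hr hκ hS.1 j).1
  have hU : ∀ i, M.logBiasZero T i =
      (M.stage S i.succ).2 + M.price i * (M.stage S i.succ).1 := fun i => by
    rw [logBiasZero, ← tailLog_succ, hTdef, tailLog_stage]
  have hstart : ∀ i, M.IsStart i (M.logBiasZero T i) (T i.succ) (T i.castSucc) := fun i => by
    rw [hU]
    exact isStart_stage hr hκ hS.1 i
  have hmonoT : Monotone T := Fin.monotone_iff_le_succ.2 fun i => (hstart i).le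
  have hlast : T (Fin.last n) = S := by simp [hTdef]
  have hH1 : (M.stage S 0).2 + P * (M.stage S 0).1 - L ≤ 0 := (le_max_left _ _).trans_eq hSH
  have hH2 : M.requiredVar k (M.logBiasZero T k) (T k.succ) 0 - M.σ₀ k ^ 2 ≤ 0 := by
    rw [hU]
    exact (le_max_right _ _).trans_eq hSH
  -- The components before `k` and the start of `k` are at time `0`.
  have hTk : T k.castSucc = 0 := by
    by_contra hne
    have hpos : 0 < T k.castSucc := (hT _).lt_of_ne' hne
    have h1 := (hstart k).tight.resolve_left hne
    have h2 := price_mul_stage_le hr hκ hS.1 k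
    rw [← hU] at h2
    have h3 := requiredVar_strictAntiOn hr hσ hκ k h2 (hpos.le.trans (hstart k).le)
      (hstart k).le hpos
    linarith
  have hTlow : ∀ j, j ≤ k.castSucc → T j = 0 := fun j hj =>
    le_antisymm (hTk ▸ hmonoT hj) (hT j)
  have hT0 : T 0 = 0 := hTlow 0 (Fin.zero_le _)
  have hstage0 : M.tailLog T 0 = (M.stage S 0).2 := by rw [hTdef, tailLog_stage]
  rw [show (M.stage S 0).1 = 0 from hT0, mul_zero, add_zero, ← hstage0] at hH1
  obtain ⟨i₀, hi₀, hi₀min⟩ : ∃ i₀ : Fin n, 0 < T i₀.succ ∧ ∀ i < i₀, T i.succ = 0 := by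
    have hne : {i : Fin n | 0 < T i.succ}.Nonempty := by
      have : Fin.last n ≠ 0 := fun h => by
        rw [h, hT0] at hlast
        exact hSpos.ne hlast
      obtain ⟨i, hi⟩ := Fin.exists_succ_eq.2 this
      exact ⟨i, by simpa [hi, hlast] using hSpos⟩
    obtain ⟨i, hi⟩ := WellFounded.has_min (wellFounded_lt (α := Fin n)) _ hne
    exact ⟨i, hi.1, fun j hj => le_antisymm (not_lt.1 fun h => hi.2 j h hj) (hT _)⟩
  have hbefore : ∀ i : Fin n, i.castSucc < i₀.castSucc → T i.succ = 0 := fun i hi =>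
    hi₀min i (Fin.castSucc_lt_castSucc_iff.1 hi)
  have hcv := varPath_zero (M := M) hT (fun i => (hstart i).le) hbefore
  have hstrict : ∀ i : Fin n, i₀.castSucc ≤ i.castSucc → T i.castSucc < T i.succ := fun i hi =>
    (hstart i).lt hσ (hi₀.trans_le
      (hmonoT (Fin.succ_le_succ_iff.2 (Fin.castSucc_le_castSucc_iff.1 hi))))
  have hnorm := norm_biasPath_zero (M := M) hβ0 hT (fun i => (hstart i).le) hbefore
  have hexpL : M.sigmaHat * Real.exp L = ‖M.β‖ := by
    rw [hL, Real.exp_log (div_pos hβpos hs0), mul_div_cancel₀ _ hs0.ne']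
  refine ⟨i₀.castSucc, T, hT0, hbefore, hstrict, ?_, ?_, ?_, ?_⟩
  · rw [hnorm, ← hexpL]
    have : M.tailLog T 0 ≤ L := by linarith
    gcongr
  · intro i _
    rw [hcv]
    exact (hstart i).var_le
  · intro i hi
    rw [hcv]
    refine (hstart i).tight.resolve_left (ne_of_gt ?_)
    obtain ⟨j, hj⟩ := Fin.exists_succ_eq.2 ((Fin.zero_le _).trans_lt hi).ne'
    have : i₀.succ ≤ i.castSucc := Fin.succ_le_castSucc_iff.2 (Fin.castSucc_lt_castSucc_iff.1 hi)
    exact hi₀.trans_le (hmonoT this)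
  · rcases max_choice ((M.stage S 0).2 + P * (M.stage S 0).1 - L)
      (M.requiredVar k ((M.stage S k.succ).2 + M.price k * (M.stage S k.succ).1)
      (M.stage S k.succ).1 0 - M.σ₀ k ^ 2) with hmax | hmax
    · left
      have h1 : (M.stage S 0).2 + P * (M.stage S 0).1 - L = 0 := hmax.symm.trans hSH
      rw [show (M.stage S 0).1 = 0 from hT0, mul_zero, add_zero, ← hstage0] at h1
      rw [hnorm, sub_eq_zero.1 h1, hexpL]
    · right
      have h1 : M.requiredVar k (M.logBiasZero T k) (T k.succ) 0 - M.σ₀ k ^ 2 = 0 := by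
        rw [hU]
        exact hmax.symm.trans hSH
      have hTks : 0 < T k.succ := by
        refine (hT _).lt_of_ne fun h => ?_
        rw [← h] at h1
        have := requiredVar_self_nonpos (M := M) k (M.logBiasZero T k) le_rfl
        linarith
      intro i
      rw [hcv]
      rcases lt_trichotomy i k with hik | rfl | hik
      · have h2 : T i.succ = 0 :=
          hTlow _ (Fin.succ_le_castSucc_iff.2 hik)
        have h3 : T i.castSucc = 0 := hTlow _ (Fin.castSucc_le_castSucc_iff.2 hik.le)
        simp [h2, h3, requiredVar, hkmin i hik]
      · rw [hTk]
        linarith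
      · refine (hstart i).tight.resolve_left (ne_of_gt ?_)
        exact hTks.trans_le (hmonoT (Fin.succ_le_castSucc_iff.2 hik))

theorem existsUnique_isSchedule (hr : 0 < M.r) (hσ : ∀ i, 0 < M.σ i)
    (hκ : ∀ i, 2 * M.κ i < M.r) (hmono : Monotone M.κ) (hβ : M.sigmaHat < ‖M.β‖) :
    ∃! p : Fin (n + 1) × (Fin (n + 1) → ℝ), M.IsSchedule p.1 p.2 := by
  obtain ⟨c, T, h⟩ := exists_isSchedule hr hσ hκ hβ
  refine ⟨(c, T), h, ?_⟩
  rintro ⟨c', T'⟩ (h' : M.IsSchedule c' T')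
  have hlast : T' (Fin.last n) = T (Fin.last n) :=
    le_antisymm (h.last_le hr hσ hκ hmono hβ h') (h'.last_le hr hσ hκ hmono hβ h)
  have hT : T' = T := by
    ext j
    have h1 := eq_stage hr hσ hκ (h.nonneg _) h.isStart j
    have h2 := eq_stage hr hσ hκ (h'.nonneg _) h'.isStart j
    rw [hlast, h1] at h2
    exact (congrArg Prod.fst h2).symm
  subst hT
  rw [le_antisymm (h'.critical_unique h) (h.critical_unique h')]

/-! ### The bias path of a schedule -/

variable (M) in
/-- The logarithm of the bias over `σ̂` at time `t ≥ 0`, for the full-disclosure times `T`. -/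
def logBias (T : Fin (n + 1) → ℝ) (t : ℝ) : ℝ :=
  ∑ i : Fin n, M.price i * max (T i.succ - max t (T i.castSucc)) 0

variable (M) in
/-- The rate at which the bias decays: the price of the component that is partially revealed. -/
def decayRate (T : Fin (n + 1) → ℝ) (t : ℝ) : ℝ :=
  ∑ i : Fin n, (Ico (T i.castSucc) (T i.succ)).indicator (fun _ => M.price i) t

variable (M) in
/-- The marginal value of discounted bias reduction, `1` plus the cumulative Lagrange multiplier of
the obedience constraints up to time `t`. -/
def multiplier (T : Fin (n + 1) → ℝ) (t : ℝ) : ℝ :=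
  ‖M.β‖ / M.sigmaHat * Real.exp (-M.logBias T t)

theorem hasDerivWithinAt_max_sub_max (a b t : ℝ) :
    HasDerivWithinAt (fun t => max (b - max t a) 0)
      (-(Ico a b).indicator (fun _ => (1 : ℝ)) t) (Ici t) t := by
  rcases lt_or_ge t a with h1 | h1
  · rw [indicator_of_notMem (fun h => absurd h.1 (not_le.2 h1)), neg_zero]
    refine ((hasDerivAt_const t (max (b - a) 0)).congr_of_eventuallyEq ?_).hasDerivWithinAt
    filter_upwards [eventually_lt_nhds h1] with s hs
    rw [max_eq_right hs.le]
  rcases lt_or_ge t b with h2 | h2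
  · rw [indicator_of_mem (show t ∈ Ico a b from ⟨h1, h2⟩)]
    refine (((hasDerivAt_id' t).const_sub b).hasDerivWithinAt).congr_of_eventuallyEq ?_ ?_
    · filter_upwards [self_mem_nhdsWithin, mem_nhdsWithin_of_mem_nhds (eventually_lt_nhds h2)]
        with s hs hs'
      rw [max_eq_left (h1.trans hs), max_eq_left (sub_nonneg.2 (le_of_lt hs'))]
    · rw [max_eq_left h1, max_eq_left (sub_nonneg.2 h2.le)]
  · rw [indicator_of_notMem (fun h => absurd h.2 (not_lt.2 h2)), neg_zero]
    have h0 : ∀ s, t ≤ s → max (b - max s a) 0 = 0 := fun s hs =>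
      max_eq_right (sub_nonpos.2 (h2.trans (hs.trans (le_max_left _ _))))
    exact (hasDerivWithinAt_const t (Ici t) (0 : ℝ)).congr (fun s hs => h0 s hs) (h0 t le_rfl)

theorem hasDerivWithinAt_logBias (T : Fin (n + 1) → ℝ) (t : ℝ) :
    HasDerivWithinAt (M.logBias T) (-M.decayRate T t) (Ici t) t := by
  have h := HasDerivWithinAt.fun_sum fun (i : Fin n) (_ : i ∈ Finset.univ) =>
    (hasDerivWithinAt_max_sub_max (T i.castSucc) (T i.succ) t).const_mul (M.price i)
  refine h.congr_deriv ?_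
  rw [decayRate, ← Finset.sum_neg_distrib]
  refine Finset.sum_congr rfl fun i _ => ?_
  by_cases ht : t ∈ Ico (T i.castSucc) (T i.succ) <;> simp [ht]

theorem continuous_logBias (T : Fin (n + 1) → ℝ) : Continuous (M.logBias T) := by
  unfold logBias
  fun_prop

theorem logBias_nonneg (hκ : ∀ i, 2 * M.κ i < M.r) (T : Fin (n + 1) → ℝ) (t : ℝ) :
    0 ≤ M.logBias T t :=
  Finset.sum_nonneg fun i _ => mul_nonneg (M.price_pos hκ i).le (le_max_right _ _)

theorem decayRate_nonneg (hκ : ∀ i, 2 * M.κ i < M.r) (T : Fin (n + 1) → ℝ) (t : ℝ) :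
    0 ≤ M.decayRate T t :=
  Finset.sum_nonneg fun i _ => indicator_nonneg (fun _ _ => (M.price_pos hκ i).le) _

theorem integrable_decayRate (T : Fin (n + 1) → ℝ) : Integrable (M.decayRate T) := by
  refine integrable_finsetSum _ fun i _ => ?_
  exact (integrable_indicator_iff measurableSet_Ico).2 (by simp [integrableOn_const_iff])

theorem continuous_multiplier (T : Fin (n + 1) → ℝ) : Continuous (M.multiplier T) := by
  have := continuous_logBias (M := M) T
  unfold multiplier
  fun_prop

theorem multiplier_nonneg (T : Fin (n + 1) → ℝ) (t : ℝ) : 0 ≤ M.multiplier T t :=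
  mul_nonneg (div_nonneg (norm_nonneg _) (Real.sqrt_nonneg _)) (Real.exp_pos _).le

theorem multiplier_le (hκ : ∀ i, 2 * M.κ i < M.r) (T : Fin (n + 1) → ℝ) (t : ℝ) :
    M.multiplier T t ≤ ‖M.β‖ / M.sigmaHat :=
  mul_le_of_le_one_right (div_nonneg (norm_nonneg _) (Real.sqrt_nonneg _))
    (Real.exp_le_one_iff.2 (neg_nonpos.2 (logBias_nonneg hκ T t)))

theorem integrable_decayRate_mul_multiplier (hκ : ∀ i, 2 * M.κ i < M.r) (T : Fin (n + 1) → ℝ) :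
    Integrable fun t => M.decayRate T t * M.multiplier T t := by
  refine (integrable_decayRate T).mul_bdd (c := ‖M.β‖ / M.sigmaHat)
    (continuous_multiplier T).aestronglyMeasurable (Filter.Eventually.of_forall fun t => ?_)
  rw [Real.norm_of_nonneg (multiplier_nonneg T t)]
  exact multiplier_le hκ T t

theorem multiplier_sub_multiplier (hκ : ∀ i, 2 * M.κ i < M.r) (T : Fin (n + 1) → ℝ)
    {a s : ℝ} (h : a ≤ s) :
    ∫ u in a..s, M.decayRate T u * M.multiplier T u = M.multiplier T s - M.multiplier T a := by
  refine intervalIntegral.integral_eq_sub_of_hasDeriv_right_of_le h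
    (continuous_multiplier T).continuousOn (fun u _ => ?_)
    (integrable_decayRate_mul_multiplier hκ T).intervalIntegrable
  have h1 := ((hasDerivWithinAt_logBias (M := M) T u).neg.exp.const_mul
    (‖M.β‖ / M.sigmaHat)).mono Ioi_subset_Ici_self
  refine h1.congr_deriv ?_
  simp only [multiplier, Pi.neg_apply]
  ring


/-- A time is either past full disclosure or in the partial-disclosure interval of a component. -/
theorem exists_mem_Ico_of_lt {T : Fin (n + 1) → ℝ} {t : ℝ} (h0 : T 0 ≤ t)
    (h1 : t < T (Fin.last n)) : ∃ k : Fin n, t ∈ Ico (T k.castSucc) (T k.succ) := by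
  by_contra! hne
  have hle : ∀ j, T j ≤ t := fun j => by
    induction j using Fin.induction with
    | zero => exact h0
    | succ i ih =>
      by_contra! hlt
      exact hne i ⟨ih, hlt⟩
  exact absurd h1 (not_lt.2 (hle _))

theorem decayRate_eq {T : Fin (n + 1) → ℝ} (hT : Monotone T) {k : Fin n} {t : ℝ}
    (hk : t ∈ Ico (T k.castSucc) (T k.succ)) : M.decayRate T t = M.price k := by
  rw [decayRate, Finset.sum_eq_single k, indicator_of_mem hk]
  · intro i _ hik
    refine indicator_of_notMem (fun hi => ?_) _
    rcases hik.lt_or_gt with hlt | hlt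
    · exact absurd (hi.2.trans_le (hT (Fin.succ_le_castSucc_iff.2 hlt))) (not_lt.2 hk.1)
    · exact absurd (hk.2.trans_le (hT (Fin.succ_le_castSucc_iff.2 hlt))) (not_lt.2 hi.1)
  · simp

theorem decayRate_eq_zero {T : Fin (n + 1) → ℝ} (hT : Monotone T) {t : ℝ}
    (ht : T (Fin.last n) ≤ t) : M.decayRate T t = 0 :=
  Finset.sum_eq_zero fun _ _ => indicator_of_notMem
    (fun hi => absurd hi.2 (not_lt.2 ((hT (Fin.le_last _)).trans ht))) _

theorem logBias_eq_zero {T : Fin (n + 1) → ℝ} (hT : Monotone T) {t : ℝ}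
    (ht : T (Fin.last n) ≤ t) : M.logBias T t = 0 :=
  Finset.sum_eq_zero fun i _ => by
    have h1 : T i.succ ≤ t := (hT (Fin.le_last _)).trans ht
    rw [max_eq_right (sub_nonpos.2 (h1.trans (le_max_left _ _))), mul_zero]

theorem logBias_eq {T : Fin (n + 1) → ℝ} (hT : Monotone T) {k : Fin n} {t : ℝ}
    (hk : t ∈ Icc (T k.castSucc) (T k.succ)) :
    M.logBias T t = M.tauSucc T k + M.price k * (T k.succ - t) := by
  have h1 : (∑ i ∈ insert k (Finset.Ioi k), M.price i * max (T i.succ - max t (T i.castSucc)) 0) =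
      M.logBias T t := by
    refine Finset.sum_subset (Finset.subset_univ _) fun i _ hi => ?_
    have hik : i < k := by
      simp only [Finset.mem_insert, Finset.mem_Ioi, not_or, not_lt] at hi
      exact hi.2.lt_of_ne hi.1
    have h2 : T i.succ ≤ t := (hT (Fin.succ_le_castSucc_iff.2 hik)).trans hk.1
    rw [max_eq_right (sub_nonpos.2 (h2.trans (le_max_left _ _))), mul_zero]
  rw [← h1, Finset.sum_insert (by simp), add_comm, max_eq_left hk.1,
    max_eq_left (sub_nonneg.2 hk.2), tauSucc]
  congr 1
  refine Finset.sum_congr rfl fun i hi => ?_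
  have h2 : t ≤ T i.castSucc :=
    hk.2.trans (hT (Fin.succ_le_castSucc_iff.2 (Finset.mem_Ioi.1 hi)))
  rw [max_eq_right h2, max_eq_left (sub_nonneg.2 (hT Fin.castSucc_lt_succ.le))]

variable {c : Fin (n + 1)} {T : Fin (n + 1) → ℝ}

theorem biasPath_eq (h : M.IsSchedule c T) {t : ℝ} (ht : 0 ≤ t) : M.biasPath c T t =
    (M.sigmaHat * Real.exp (M.logBias T t)) • (‖M.β‖⁻¹ • M.β) := by
  rw [biasPath, sum_filter_eq h.before ht, logBias]

theorem norm_biasPath_eq (h : M.IsSchedule c T) (hβ : M.β ≠ 0) {t : ℝ} (ht : 0 ≤ t) :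
    ‖M.biasPath c T t‖ = M.sigmaHat * Real.exp (M.logBias T t) := by
  rw [norm_biasPath hβ, sum_filter_eq h.before ht, logBias]

/-- The first-order condition for the bias. -/
theorem multiplier_smul_biasPath (h : M.IsSchedule c T) (hs : 0 < M.sigmaHat) (hβ : M.β ≠ 0)
    {t : ℝ} (ht : 0 ≤ t) : M.multiplier T t • M.biasPath c T t = M.β := by
  have h1 : ‖M.β‖ ≠ 0 := norm_ne_zero_iff.2 hβ
  rw [biasPath_eq h ht, multiplier, smul_smul, smul_smul, Real.exp_neg]
  have h2 := (Real.exp_pos (M.logBias T t)).ne'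
  rw [show ‖M.β‖ / M.sigmaHat * (Real.exp (M.logBias T t))⁻¹ *
    (M.sigmaHat * Real.exp (M.logBias T t)) * ‖M.β‖⁻¹ = 1 by field_simp, one_smul]

theorem norm_biasPath_decay (h : M.IsSchedule c T) (hβ : M.β ≠ 0) (i : Fin n) {t : ℝ}
    (ht : t ∈ Icc (T i.castSucc) (T i.succ)) : ‖M.biasPath c T t‖ =
      ‖M.biasPath c T (T i.castSucc)‖ * Real.exp (-(M.r - 2 * M.κ i) * (t - T i.castSucc)) := by
  have h0 := h.nonneg i.castSucc
  rw [norm_biasPath_eq h hβ (h0.trans ht.1), norm_biasPath_eq h hβ h0, mul_assoc, ← Real.exp_add,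
    logBias_eq h.monotone ht, logBias_eq h.monotone ⟨le_rfl, ht.1.trans ht.2⟩, price]
  congr 2
  ring

/-! ### The variance path of a schedule -/

theorem varPath_of_succ_le (h : M.IsSchedule c T) {i : Fin n} {t : ℝ} (ht : T i.succ ≤ t) :
    M.varPath c T t i = 0 := by
  have h1 : T i.castSucc ≤ t := (h.monotone Fin.castSucc_lt_succ.le).trans ht
  rw [varPath, if_pos h1, varLate, max_eq_right (sub_nonpos.2 ht)]
  simp

theorem le_castSucc_of_lt (h : M.IsSchedule c T) {i : Fin n} {t : ℝ} (h0 : 0 ≤ t)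
    (ht : t < T i.succ) : c ≤ i.castSucc := by
  by_contra! hc
  rw [h.before i hc] at ht
  exact absurd ht (not_lt.2 h0)

theorem varPath_of_mem (h : M.IsSchedule c T) {i : Fin n} {t : ℝ}
    (ht : t ∈ Ico (T i.castSucc) (T i.succ)) :
    M.varPath c T t i = M.late i (M.tauSucc T i) (T i.succ - t) := by
  have hc := le_castSucc_of_lt h ((h.nonneg _).trans ht.1) ht.2
  rw [varPath, if_neg (not_lt.2 hc), if_pos ht.1, varLate, late,
    max_eq_left (sub_nonneg.2 ht.2.le)]

theorem varPath_of_lt (h : M.IsSchedule c T) {i : Fin n} {t : ℝ} (h0 : 0 ≤ t)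
    (ht : t < T i.castSucc) : M.varPath c T t i = M.η i (M.σ₀ i ^ 2) t := by
  have hc : c < i.castSucc := by
    by_contra! hc
    rw [h.eq_zero hc] at ht
    exact absurd ht (not_lt.2 h0)
  rw [← h.later i hc, varPath, if_neg (not_lt.2 hc.le), if_neg (not_le.2 ht), varPath,
    if_neg (not_lt.2 hc.le), if_neg (not_le.2 (h0.trans_lt ht)), eta_eta]
  congr 1
  ring

theorem continuous_varPath (hr : 0 < M.r) (hκ : ∀ i, 2 * M.κ i < M.r) (c : Fin (n + 1))
    (T : Fin (n + 1) → ℝ) (i : Fin n) : Continuous fun t => M.varPath c T t i := by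
  unfold varPath
  by_cases hc : i.castSucc < c
  · simp only [if_pos hc]
    exact continuous_const
  · simp only [if_neg hc]
    have hl : Continuous (M.varLate T i) :=
      (M.continuous_late hr hκ i (M.tauSucc T i)).comp (by fun_prop : Continuous fun t : ℝ =>
        max (T i.succ - t) 0)
    have he : Continuous fun t => M.η i (M.varLate T i (T i.castSucc)) (t - T i.castSucc) := by
      have := continuous_expGap (M.κ i)
      unfold η
      fun_prop
    exact hl.if_le he continuous_const continuous_id fun t ht => by simp [← ht]

theorem tauSucc_nonneg (hκ : ∀ i, 2 * M.κ i < M.r) (h : M.IsSchedule c T) (i : Fin n) :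
    0 ≤ M.tauSucc T i :=
  Finset.sum_nonneg fun j _ => mul_nonneg (M.price_pos hκ j).le
    (sub_nonneg.2 (h.monotone Fin.castSucc_lt_succ.le))

theorem varPath_nonneg (hr : 0 < M.r) (hσ : ∀ i, 0 < M.σ i) (hκ : ∀ i, 2 * M.κ i < M.r)
    (h : M.IsSchedule c T) (i : Fin n) {t : ℝ} (ht : 0 ≤ t) : 0 ≤ M.varPath c T t i := by
  rcases lt_or_ge t (T i.castSucc) with h1 | h1
  · rw [varPath_of_lt h ht h1]
    exact M.eta_nonneg (sq_nonneg _) ht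
  rcases lt_or_ge t (T i.succ) with h2 | h2
  · rw [varPath_of_mem h ⟨h1, h2⟩]
    exact (late_pos M hr hσ hκ i (tauSucc_nonneg hκ h i) (sub_pos.2 h2)).le
  · rw [varPath_of_succ_le h h2]

theorem varPath_eq_zero_iff (hr : 0 < M.r) (hσ : ∀ i, 0 < M.σ i) (hκ : ∀ i, 2 * M.κ i < M.r)
    (h : M.IsSchedule c T) (i : Fin n) {t : ℝ} (ht : 0 < t) :
    M.varPath c T t i = 0 ↔ T i.succ ≤ t := by
  refine ⟨fun h0 => ?_, varPath_of_succ_le h⟩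
  by_contra! h2
  refine absurd h0 (ne_of_gt ?_)
  rcases lt_or_ge t (T i.castSucc) with h1 | h1
  · rw [varPath_of_lt h ht.le h1]
    exact M.eta_pos hσ (sq_nonneg _) ht
  · rw [varPath_of_mem h ⟨h1, h2⟩]
    exact late_pos M hr hσ hκ i (tauSucc_nonneg hκ h i) (sub_pos.2 h2)

variable (M) in
/-- The rate at which disclosure reduces the variance of component `i` below the no-disclosure
flow, in units of `price i`. -/
def disclosure (T : Fin (n + 1) → ℝ) (i : Fin n) (t : ℝ) : ℝ :=
  if t < T i.castSucc then 0
  else if t < T i.succ then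
    M.sigmaHat ^ 2 * Real.exp (2 * M.logBias T t) - M.sigmaHatSq i + M.σ i ^ 2 / M.price i
  else M.σ i ^ 2 / M.price i

theorem sigmaHat_sq_le_bias (hκ : ∀ i, 2 * M.κ i < M.r) (T : Fin (n + 1) → ℝ) (t : ℝ) :
    M.sigmaHat ^ 2 ≤ M.sigmaHat ^ 2 * Real.exp (2 * M.logBias T t) :=
  le_mul_of_one_le_right (sq_nonneg _)
    (Real.one_le_exp (by linarith [logBias_nonneg hκ T t]))

theorem disclosure_nonneg (hκ : ∀ i, 2 * M.κ i < M.r) (T : Fin (n + 1) → ℝ) (i : Fin n) (t : ℝ) :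
    0 ≤ M.disclosure T i t := by
  have h1 : 0 ≤ M.σ i ^ 2 / M.price i := div_nonneg (sq_nonneg _) (M.price_pos hκ i).le
  unfold disclosure
  split_ifs
  · exact le_rfl
  · have := sigmaHat_sq_le_bias hκ T t
    have := M.sigmaHatSq_le hκ i
    linarith
  · exact h1

/-- The total disclosure supports the squared bias. -/
theorem sum_disclosure (hκ : ∀ i, 2 * M.κ i < M.r) (hT : Monotone T) {t : ℝ} (ht : T 0 ≤ t) :
    ∑ i, M.disclosure T i t = M.sigmaHat ^ 2 * Real.exp (2 * M.logBias T t) := by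
  have hle : ∀ i : Fin n, T i.castSucc ≤ T i.succ := fun i => hT Fin.castSucc_lt_succ.le
  rcases le_or_gt (T (Fin.last n)) t with h1 | h1
  · rw [logBias_eq_zero hT h1, mul_zero, Real.exp_zero, mul_one, M.sigmaHat_sq hκ]
    refine Finset.sum_congr rfl fun i _ => ?_
    have h2 : T i.succ ≤ t := (hT (Fin.le_last _)).trans h1
    rw [disclosure, if_neg (not_lt.2 ((hle i).trans h2)), if_neg (not_lt.2 h2)]
  · obtain ⟨k, hk⟩ := exists_mem_Ico_of_lt ht h1
    have h2 : ∑ i ∈ insert k (Finset.Iio k), M.disclosure T i t = ∑ i, M.disclosure T i t := by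
      refine Finset.sum_subset (Finset.subset_univ _) fun i _ hi => ?_
      have hik : k < i := by
        simp only [Finset.mem_insert, Finset.mem_Iio, not_or, not_lt] at hi
        exact hi.2.lt_of_ne' hi.1
      rw [disclosure, if_pos (hk.2.trans_le (hT (Fin.succ_le_castSucc_iff.2 hik)))]
    have h3 : ∑ i ∈ Finset.Iio k, M.disclosure T i t =
        ∑ i ∈ Finset.Iio k, M.σ i ^ 2 / M.price i := by
      refine Finset.sum_congr rfl fun i hi => ?_
      have h4 : T i.succ ≤ t :=
        (hT (Fin.succ_le_castSucc_iff.2 (Finset.mem_Iio.1 hi))).trans hk.1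
      rw [disclosure, if_neg (not_lt.2 ((hle i).trans h4)), if_neg (not_lt.2 h4)]
    rw [← h2, Finset.sum_insert (by simp), h3, disclosure, if_neg (not_lt.2 hk.1), if_pos hk.2,
      sigmaHatSq_eq]
    ring

theorem hasDerivWithinAt_varPath (hr : 0 < M.r) (hκ : ∀ i, 2 * M.κ i < M.r)
    (h : M.IsSchedule c T) (i : Fin n) {t : ℝ} (ht : 0 ≤ t) :
    HasDerivWithinAt (fun t => M.varPath c T t i)
      (2 * M.κ i * M.varPath c T t i + M.σ i ^ 2 - M.price i * M.disclosure T i t) (Ici t) t := by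
  have hp := (M.price_pos hκ i).ne'
  rcases lt_or_ge t (T i.castSucc) with h1 | h1
  · rw [disclosure, if_pos h1, mul_zero, sub_zero, varPath_of_lt h ht h1]
    have h2 : HasDerivAt (fun t : ℝ => 2 * M.κ i * t) (2 * M.κ i) t := by
      simpa using (hasDerivAt_id' t).const_mul (2 * M.κ i)
    have h3 : HasDerivAt (M.η i (M.σ₀ i ^ 2))
        (2 * M.κ i * M.η i (M.σ₀ i ^ 2) t + M.σ i ^ 2) t := by
      refine ((h2.exp.mul_const (M.σ₀ i ^ 2)).add
        ((hasDerivAt_expGap (M.κ i) t).const_mul (M.σ i ^ 2))).congr_deriv ?_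
      rw [η]
      linear_combination -M.σ i ^ 2 * two_mul_mul_expGap (M.κ i) t
    refine h3.hasDerivWithinAt.congr_of_eventuallyEq ?_ (varPath_of_lt h ht h1)
    filter_upwards [self_mem_nhdsWithin, mem_nhdsWithin_of_mem_nhds (eventually_lt_nhds h1)]
      with s hs hs' using varPath_of_lt h (ht.trans hs) hs'
  rcases lt_or_ge t (T i.succ) with h2 | h2
  · rw [disclosure, if_neg (not_lt.2 h1), if_pos h2, varPath_of_mem h ⟨h1, h2⟩]
    have h3 := (M.hasDerivAt_late hr hκ i (M.tauSucc T i) (T i.succ - t)).comp t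
      ((hasDerivAt_id' t).const_sub (T i.succ))
    refine (h3.hasDerivWithinAt.congr_of_eventuallyEq ?_ ?_).congr_deriv ?_
    · filter_upwards [self_mem_nhdsWithin, mem_nhdsWithin_of_mem_nhds (eventually_lt_nhds h2)]
        with s hs hs' using varPath_of_mem h ⟨h1.trans hs, hs'⟩
    · exact varPath_of_mem h ⟨h1, h2⟩
    · rw [logBias_eq h.monotone ⟨h1, h2.le⟩, mul_add 2, ← mul_assoc 2]
      field_simp
      ring
  · rw [disclosure, if_neg (not_lt.2 h1), if_neg (not_lt.2 h2), varPath_of_succ_le h h2,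
      mul_div_cancel₀ _ hp, mul_zero, zero_add, sub_self]
    exact (hasDerivWithinAt_const t (Ici t) (0 : ℝ)).congr
      (fun s hs => varPath_of_succ_le h (h2.trans hs)) (varPath_of_succ_le h h2)

theorem varPath_le_eta (hr : 0 < M.r) (hκ : ∀ i, 2 * M.κ i < M.r)
    (h : M.IsSchedule c T) (i : Fin n) {t s : ℝ} (ht : 0 ≤ t) (hts : t ≤ s) :
    M.varPath c T s i ≤ M.η i (M.varPath c T t i) (s - t) := by
  rw [le_eta_sub_iff]
  have hd : ∀ x ∈ Ico t s, HasDerivWithinAt (fun t => M.η i (M.varPath c T t i) (-t))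
      (-(Real.exp (-(2 * M.κ i * x)) * (M.price i * M.disclosure T i x))) (Ici x) x := by
    intro x hx
    refine (M.hasDerivWithinAt_eta_neg
      (hasDerivWithinAt_varPath hr hκ h i (ht.trans hx.1))).congr_deriv ?_
    ring
  have hc : Continuous fun t => M.η i (M.varPath c T t i) (-t) := by
    have h1 := continuous_varPath hr hκ c T i
    have h2 := continuous_expGap (M.κ i)
    unfold η
    fun_prop
  refine image_le_of_deriv_right_le_deriv_boundary hc.continuousOn hd le_rfl continuousOn_const
    (fun x _ => hasDerivWithinAt_const x (Ici x) (M.η i (M.varPath c T t i) (-t)))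
    (fun x _ => ?_) ⟨hts, le_rfl⟩
  exact neg_nonpos.2 (mul_nonneg (Real.exp_pos _).le
    (mul_nonneg (M.price_pos hκ i).le (disclosure_nonneg hκ T i x)))

/-! ### Obedience -/

variable (M) in
/-- The receiver's loss flow, discounted to time `0`. -/
def lossFlow (b : ℝ → EuclideanSpace ℝ (Fin n)) (v : ℝ → Fin n → ℝ) (s : ℝ) : ℝ :=
  M.r * Real.exp (-M.r * s) * ∑ i, (b s i ^ 2 + v s i)

variable (M) in
/-- The loss, discounted to time `0`, that the receiver incurs from time `t` on if the sender
provides no information any more. -/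
def outsideLoss (v : ℝ → Fin n → ℝ) (t : ℝ) : ℝ :=
  Real.exp (-M.r * t) * ∑ i, (M.σ i ^ 2 + M.r * v t i) / M.price i

theorem obedience_iff (b : ℝ → EuclideanSpace ℝ (Fin n)) (v : ℝ → Fin n → ℝ) (t : ℝ) :
    (-∑ i, (M.σ i ^ 2 + M.r * v t i) / M.price i ≤
      -∫ s in Ioi t, M.r * Real.exp (-M.r * (s - t)) * ∑ i, (b s i ^ 2 + v s i)) ↔
    ∫ s in Ioi t, M.lossFlow b v s ≤ M.outsideLoss v t := by
  have h1 : ∀ s, M.r * Real.exp (-M.r * (s - t)) * ∑ i, (b s i ^ 2 + v s i) =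
      Real.exp (M.r * t) * M.lossFlow b v s := fun s => by
    rw [show -M.r * (s - t) = M.r * t + -M.r * s by ring, Real.exp_add, lossFlow]
    ring
  simp only [h1, integral_const_mul, neg_le_neg_iff]
  have h2 : Real.exp (M.r * t) * M.outsideLoss v t =
      ∑ i, (M.σ i ^ 2 + M.r * v t i) / M.price i := by
    rw [outsideLoss, ← mul_assoc, ← Real.exp_add]
    simp
  rw [← h2, mul_le_mul_iff_right₀ (Real.exp_pos _)]

theorem Feasible.integrableOn_lossFlow {b : ℝ → EuclideanSpace ℝ (Fin n)} {v : ℝ → Fin n → ℝ}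
    (h : M.Feasible b v) : IntegrableOn (M.lossFlow b v) (Ioi 0) := by
  have h1 := (h.integrable.mono_set Ioi_subset_Ici_self).const_mul M.r
  exact h1.congr (Filter.Eventually.of_forall fun s => by simp only [lossFlow, mul_assoc])

theorem Feasible.integral_lossFlow_le {b : ℝ → EuclideanSpace ℝ (Fin n)} {v : ℝ → Fin n → ℝ}
    (h : M.Feasible b v) {t : ℝ} (ht : 0 ≤ t) :
    ∫ s in Ioi t, M.lossFlow b v s ≤ M.outsideLoss v t :=
  (obedience_iff b v t).1 (h.obedience t ht)

variable {c : Fin (n + 1)} {T : Fin (n + 1) → ℝ}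

theorem sum_biasPath_sq (h : M.IsSchedule c T) (hβ : M.β ≠ 0) {t : ℝ} (ht : 0 ≤ t) :
    ∑ i, M.biasPath c T t i ^ 2 = M.sigmaHat ^ 2 * Real.exp (2 * M.logBias T t) := by
  rw [← EuclideanSpace.real_norm_sq_eq, norm_biasPath_eq h hβ ht, mul_pow, ← Real.exp_nat_mul]
  norm_num

theorem continuousOn_biasPath (h : M.IsSchedule c T) : ContinuousOn (M.biasPath c T) (Ici 0) := by
  have hc : Continuous fun t => (M.sigmaHat * Real.exp (M.logBias T t)) • (‖M.β‖⁻¹ • M.β) := by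
    have := continuous_logBias (M := M) T
    fun_prop
  exact hc.continuousOn.congr fun t ht => biasPath_eq h ht

theorem continuousOn_sum_biasPath_varPath (hr : 0 < M.r) (hκ : ∀ i, 2 * M.κ i < M.r)
    (h : M.IsSchedule c T) (hβ : M.β ≠ 0) :
    ContinuousOn (fun s => ∑ i, (M.biasPath c T s i ^ 2 + M.varPath c T s i)) (Ici 0) := by
  have hc : Continuous fun s => M.sigmaHat ^ 2 * Real.exp (2 * M.logBias T s) +
      ∑ i, M.varPath c T s i := by
    have h1 := continuous_logBias (M := M) T
    have h2 : Continuous fun s => ∑ i, M.varPath c T s i :=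
      continuous_finsetSum _ fun i _ => continuous_varPath hr hκ c T i
    fun_prop
  refine hc.continuousOn.congr fun s hs => ?_
  simp only [Finset.sum_add_distrib, sum_biasPath_sq h hβ hs]

theorem integrableOn_biasPath_varPath (hr : 0 < M.r) (hκ : ∀ i, 2 * M.κ i < M.r)
    (h : M.IsSchedule c T) (hβ : M.β ≠ 0) : IntegrableOn (fun s => Real.exp (-M.r * s) *
      ∑ i, (M.biasPath c T s i ^ 2 + M.varPath c T s i)) (Ici 0) := by
  rw [integrableOn_Ici_iff_integrableOn_Ioi]
  refine integrable_of_isBigO_exp_neg hr (ContinuousOn.mul (by fun_prop)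
    (continuousOn_sum_biasPath_varPath hr hκ h hβ)) ?_
  refine Asymptotics.IsBigO.of_bound (M.sigmaHat ^ 2) ?_
  filter_upwards [Filter.eventually_ge_atTop (T (Fin.last n))] with s hs
  have hs0 : 0 ≤ s := (h.nonneg _).trans hs
  rw [Finset.sum_add_distrib, sum_biasPath_sq h hβ hs0, logBias_eq_zero h.monotone hs,
    Finset.sum_eq_zero fun i _ =>
      varPath_of_succ_le h ((h.monotone (Fin.le_last i.succ)).trans hs)]
  simp [mul_comm]

theorem hasDerivWithinAt_outsideLoss (hr : 0 < M.r) (hκ : ∀ i, 2 * M.κ i < M.r)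
    (h : M.IsSchedule c T) (hβ : M.β ≠ 0) {t : ℝ} (ht : 0 ≤ t) :
    HasDerivWithinAt (M.outsideLoss (M.varPath c T))
      (-M.lossFlow (M.biasPath c T) (M.varPath c T) t) (Ici t) t := by
  have h1 : HasDerivAt (fun t : ℝ => -M.r * t) (-M.r) t := by
    simpa using (hasDerivAt_id' t).const_mul (-M.r)
  have h2 := HasDerivWithinAt.fun_sum fun (i : Fin n) (_ : i ∈ Finset.univ) =>
    (((hasDerivWithinAt_varPath hr hκ h i ht).const_mul M.r).const_add (M.σ i ^ 2)).div_const
      (M.price i)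
  refine (h1.exp.hasDerivWithinAt.mul h2).congr_deriv ?_
  rw [lossFlow, Finset.sum_add_distrib, sum_biasPath_sq h hβ ht,
    ← sum_disclosure hκ h.monotone (h.zero ▸ ht), ← Finset.sum_add_distrib, mul_assoc,
    ← mul_add, Finset.mul_sum, ← Finset.sum_add_distrib, mul_assoc, Finset.mul_sum,
    Finset.mul_sum, Finset.mul_sum, ← Finset.sum_neg_distrib]
  refine Finset.sum_congr rfl fun i _ => ?_
  have hp := (M.price_pos hκ i).ne'
  field_simp
  rw [price]
  ring

/-- Obedience is binding at every time. -/
theorem integral_lossFlow_eq (hr : 0 < M.r) (hκ : ∀ i, 2 * M.κ i < M.r)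
    (h : M.IsSchedule c T) (hβ : M.β ≠ 0) {t : ℝ} (ht : 0 ≤ t) :
    ∫ s in Ioi t, M.lossFlow (M.biasPath c T) (M.varPath c T) s =
      M.outsideLoss (M.varPath c T) t := by
  have hint : IntegrableOn (M.lossFlow (M.biasPath c T) (M.varPath c T)) (Ioi t) := by
    have h1 := ((integrableOn_biasPath_varPath hr hκ h hβ).mono_set
      ((Ioi_subset_Ioi ht).trans Ioi_subset_Ici_self)).const_mul M.r
    exact h1.congr (Filter.Eventually.of_forall fun s => by simp only [lossFlow, mul_assoc])
  have hcont : Continuous (M.outsideLoss (M.varPath c T)) := by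
    unfold outsideLoss
    refine Continuous.mul (by fun_prop) (continuous_finsetSum _ fun i _ => ?_)
    have := continuous_varPath hr hκ c T i
    fun_prop
  have hlim := intervalIntegral_tendsto_integral_Ioi t hint Filter.tendsto_id
  have hlim' : Filter.Tendsto (fun x => M.outsideLoss (M.varPath c T) t -
      M.outsideLoss (M.varPath c T) x) Filter.atTop
      (nhds (M.outsideLoss (M.varPath c T) t - 0)) := by
    refine tendsto_const_nhds.sub ?_
    have he : Filter.Tendsto (fun x : ℝ => Real.exp (-M.r * x) *
        ∑ i, M.σ i ^ 2 / M.price i) Filter.atTop (nhds (0 * ∑ i, M.σ i ^ 2 / M.price i)) := by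
      refine Filter.Tendsto.mul_const _ (Real.tendsto_exp_atBot.comp ?_)
      exact Filter.tendsto_id.const_mul_atTop_of_neg (neg_lt_zero.2 hr)
    rw [zero_mul] at he
    refine he.congr' ?_
    filter_upwards [Filter.eventually_ge_atTop (T (Fin.last n))] with s hs
    rw [outsideLoss]
    congr 1
    refine Finset.sum_congr rfl fun i _ => ?_
    rw [varPath_of_succ_le h ((h.monotone (Fin.le_last i.succ)).trans hs), mul_zero, add_zero]
  rw [sub_zero] at hlim'
  refine tendsto_nhds_unique hlim (hlim'.congr' ?_)
  filter_upwards [Filter.eventually_ge_atTop t] with x hx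
  have h2 := intervalIntegral.integral_eq_sub_of_hasDeriv_right_of_le hx hcont.continuousOn
    (fun u hu => (hasDerivWithinAt_outsideLoss hr hκ h hβ
      (ht.trans hu.1.le)).mono Ioi_subset_Ici_self)
    (((intervalIntegrable_iff_integrableOn_Ioc_of_le hx).2
      (hint.mono_set Ioc_subset_Ioi_self)).neg)
  rw [intervalIntegral.integral_neg] at h2
  simp only [id]
  linarith

theorem feasible_biasPath_varPath (hr : 0 < M.r) (hσ : ∀ i, 0 < M.σ i)
    (hκ : ∀ i, 2 * M.κ i < M.r) (h : M.IsSchedule c T) (hβ : M.β ≠ 0) :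
    M.Feasible (M.biasPath c T) (M.varPath c T) where
  measurable := (continuousOn_biasPath h).aestronglyMeasurable measurableSet_Ici
  integrable := integrableOn_biasPath_varPath hr hκ h hβ
  obedience t ht := (obedience_iff _ _ t).2 (integral_lossFlow_eq hr hκ h hβ ht).le
  nonneg i _ ht := varPath_nonneg hr hσ hκ h i ht
  noDisclosure i _ _ ht hts := varPath_le_eta hr hκ h i ht hts.le
  initial i := by
    rw [h.varPath_zero]
    exact (h.isStart i).var_le

end OUModel

/-! ### Duality -/

theorem integrableOn_mul_integral_Ioi {μ f : ℝ → ℝ} {a : ℝ} (hμ : IntegrableOn μ (Ioi a))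
    (hf : IntegrableOn f (Ioi a)) : IntegrableOn (fun t => μ t * ∫ s in Ioi t, f s) (Ioi a) ∧
      ∫ t in Ioi a, μ t * ∫ s in Ioi t, f s = ∫ s in Ioi a, (∫ t in a..s, μ t) * f s := by
  set ν := volume.restrict (Ioi a) with hν
  let F : ℝ × ℝ → ℝ := {x : ℝ × ℝ | x.1 < x.2}.indicator fun x => μ x.1 * f x.2
  have hF : Integrable F (ν.prod ν) :=
    (hμ.mul_prod hf).indicator (measurableSet_lt measurable_fst measurable_snd)
  have h1 : ∀ t, a < t → ∫ s, F (t, s) ∂ν = μ t * ∫ s in Ioi t, f s := fun t ht => by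
    have h2 : ∀ s, F (t, s) = μ t * (Ioi t).indicator f s := fun s => by
      by_cases hs : t < s <;> simp [F, hs]
    simp only [h2]
    rw [integral_const_mul, integral_indicator measurableSet_Ioi, hν,
      Measure.restrict_restrict measurableSet_Ioi, inter_eq_left.2 (Ioi_subset_Ioi ht.le)]
  have h3 : ∀ s, a < s → ∫ t, F (t, s) ∂ν = (∫ t in a..s, μ t) * f s := fun s hs => by
    have h4 : ∀ t, F (t, s) = (Iio s).indicator μ t * f s := fun t => by
      by_cases ht : t < s <;> simp [F, ht]
    simp only [h4]
    rw [integral_mul_const, integral_indicator measurableSet_Iio, hν,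
      Measure.restrict_restrict measurableSet_Iio, intervalIntegral.integral_of_le hs.le,
      integral_Ioc_eq_integral_Ioo]
    congr 3
    ext
    simp [and_comm]
  constructor
  · refine hF.integral_prod_left.congr ?_
    filter_upwards [ae_restrict_mem measurableSet_Ioi] with t ht using h1 t ht
  · calc ∫ t in Ioi a, μ t * ∫ s in Ioi t, f s = ∫ t, ∫ s, F (t, s) ∂ν ∂ν :=
          setIntegral_congr_fun measurableSet_Ioi fun t ht => (h1 t ht).symm
      _ = ∫ s, ∫ t, F (t, s) ∂ν ∂ν := integral_integral_swap hF
      _ = ∫ s in Ioi a, (∫ t in a..s, μ t) * f s :=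
          setIntegral_congr_fun measurableSet_Ioi fun s hs => h3 s hs

namespace OUModel

variable {n : ℕ} {M : OUModel n}

variable (M) in
/-- The sender's loss flow, discounted to time `0`. -/
def senderFlow (b : ℝ → EuclideanSpace ℝ (Fin n)) (v : ℝ → Fin n → ℝ) (s : ℝ) : ℝ :=
  M.r * Real.exp (-M.r * s) * ∑ i, ((b s i - M.β i) ^ 2 + v s i)

theorem payoff_eq (b : ℝ → EuclideanSpace ℝ (Fin n)) (v : ℝ → Fin n → ℝ) :
    M.payoff b v = -∫ s in Ioi (0 : ℝ), M.senderFlow b v s := rfl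

theorem integrableOn_exp_neg_mul (hr : 0 < M.r) :
    IntegrableOn (fun s => Real.exp (-M.r * s)) (Ioi (0 : ℝ)) :=
  exp_neg_integrableOn_Ioi 0 hr

theorem Feasible.integrableOn_senderFlow (hr : 0 < M.r) {b : ℝ → EuclideanSpace ℝ (Fin n)}
    {v : ℝ → Fin n → ℝ} (h : M.Feasible b v) : IntegrableOn (M.senderFlow b v) (Ioi 0) := by
  have hexp := integrableOn_exp_neg_mul hr
  have hint := h.integrable.mono_set Ioi_subset_Ici_self
  have hb : ∀ i, IntegrableOn (fun s => Real.exp (-M.r * s) * b s i) (Ioi 0) := fun i => by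
    have hm : AEStronglyMeasurable (fun s => b s i) (volume.restrict (Ioi (0 : ℝ))) :=
      (EuclideanSpace.proj (𝕜 := ℝ) i).continuous.comp_aestronglyMeasurable
        (h.measurable.mono_measure (Measure.restrict_mono Ioi_subset_Ici_self le_rfl))
    refine (hexp.add hint).mono' (AEStronglyMeasurable.mul hexp.aestronglyMeasurable hm) ?_
    filter_upwards [ae_restrict_mem measurableSet_Ioi] with s hs
    have hv : ∀ j ∈ Finset.univ, 0 ≤ b s j ^ 2 + v s j := fun j _ =>
      add_nonneg (sq_nonneg _) (h.nonneg j s (le_of_lt hs))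
    have h1 : b s i ^ 2 ≤ ∑ j, (b s j ^ 2 + v s j) :=
      (le_add_of_nonneg_right (h.nonneg i s (le_of_lt hs))).trans
        (Finset.single_le_sum hv (Finset.mem_univ i))
    have h2 : |b s i| ≤ 1 + b s i ^ 2 := by
      nlinarith [sq_abs (b s i), sq_nonneg (|b s i| - 1)]
    rw [norm_mul, Real.norm_of_nonneg (Real.exp_pos _).le, Real.norm_eq_abs, Pi.add_apply]
    have h3 := mul_le_mul_of_nonneg_left (h2.trans (add_le_add_right h1 1))
      (Real.exp_pos (-M.r * s)).le
    linarith
  have hsum : IntegrableOn (fun s => ∑ i, (Real.exp (-M.r * s) * b s i) * (-2 * M.r * M.β i))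
      (Ioi 0) := integrable_finsetSum _ fun i _ => (hb i).mul_const _
  refine ((h.integrableOn_lossFlow.add hsum).add
    (hexp.mul_const (M.r * ∑ i, M.β i ^ 2))).congr (Filter.Eventually.of_forall fun s => ?_)
  simp only [Pi.add_apply, lossFlow, senderFlow, Finset.mul_sum]
  rw [← Finset.sum_add_distrib, ← Finset.sum_add_distrib]
  exact Finset.sum_congr rfl fun i _ => by ring

variable {c : Fin (n + 1)} {T : Fin (n + 1) → ℝ}

variable (M c T) in
/-- The density of the sender's loss from using `(b, v)` rather than the paths of the schedule, after
summation by parts and up to a term from the obedience constraint at time `0`. Its summands measure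
the distance from the optimal bias, the violation of complementary slackness of the variance bounds,
and the slack in obedience. -/
def dualGap (b : ℝ → EuclideanSpace ℝ (Fin n)) (v : ℝ → Fin n → ℝ) (s : ℝ) : ℝ :=
  M.r * Real.exp (-M.r * s) * M.multiplier T s *
    ∑ i, ((b s i - M.biasPath c T s i) ^ 2 +
      (v s i - M.varPath c T s i) * (1 - M.decayRate T s / M.price i)) +
  M.decayRate T s * M.multiplier T s * (M.outsideLoss v s - ∫ u in Ioi s, M.lossFlow b v u)

variable (M c T) in
/-- The receiver's additional loss flow from `(b, v)` rather than the paths of the schedule. -/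
def excessFlow (b : ℝ → EuclideanSpace ℝ (Fin n)) (v : ℝ → Fin n → ℝ) (s : ℝ) : ℝ :=
  M.lossFlow b v s - M.lossFlow (M.biasPath c T) (M.varPath c T) s

theorem outsideLoss_sub (v v' : ℝ → Fin n → ℝ) (s : ℝ) :
    M.outsideLoss v s - M.outsideLoss v' s =
      M.r * Real.exp (-M.r * s) * ∑ i, (v s i - v' s i) / M.price i := by
  rw [outsideLoss, outsideLoss, ← mul_sub, ← Finset.sum_sub_distrib, Finset.mul_sum,
    Finset.mul_sum]
  exact Finset.sum_congr rfl fun i _ => by ring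

theorem integral_excessFlow (hr : 0 < M.r) (hσ : ∀ i, 0 < M.σ i)
    (hκ : ∀ i, 2 * M.κ i < M.r) (h : M.IsSchedule c T) (hβ : M.β ≠ 0)
    {b : ℝ → EuclideanSpace ℝ (Fin n)} {v : ℝ → Fin n → ℝ} (hf : M.Feasible b v) {t : ℝ}
    (ht : 0 ≤ t) : ∫ s in Ioi t, M.excessFlow c T b v s =
      (∫ s in Ioi t, M.lossFlow b v s) - M.outsideLoss (M.varPath c T) t := by
  rw [← integral_lossFlow_eq hr hκ h hβ ht]
  exact integral_sub (hf.integrableOn_lossFlow.mono_set (Ioi_subset_Ioi ht))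
    ((feasible_biasPath_varPath hr hσ hκ h hβ).integrableOn_lossFlow.mono_set (Ioi_subset_Ioi ht))

/-- The Lagrangian decomposition of the difference of the sender's losses. -/
theorem senderFlow_sub_senderFlow (hr : 0 < M.r) (hσ : ∀ i, 0 < M.σ i)
    (hκ : ∀ i, 2 * M.κ i < M.r) (h : M.IsSchedule c T) (hs : 0 < M.sigmaHat) (hβ : M.β ≠ 0)
    {b : ℝ → EuclideanSpace ℝ (Fin n)} {v : ℝ → Fin n → ℝ} (hf : M.Feasible b v) {t : ℝ}
    (ht : 0 ≤ t) : M.senderFlow b v t - M.senderFlow (M.biasPath c T) (M.varPath c T) t =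
      M.dualGap c T b v t +
        M.decayRate T t * M.multiplier T t * (∫ s in Ioi t, M.excessFlow c T b v s) -
        (M.multiplier T t - 1) * M.excessFlow c T b v t := by
  have h1 : (M.outsideLoss v t - ∫ u in Ioi t, M.lossFlow b v u) =
      M.r * Real.exp (-M.r * t) * ∑ i, (v t i - M.varPath c T t i) / M.price i -
      ∫ s in Ioi t, M.excessFlow c T b v s := by
    rw [← outsideLoss_sub, integral_excessFlow hr hσ hκ h hβ hf ht]
    ring
  have h2 : ∀ i, M.β i = M.multiplier T t * M.biasPath c T t i := fun i => by
    conv_lhs => rw [← multiplier_smul_biasPath h hs hβ ht]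
    simp
  rw [dualGap, h1]
  generalize (∫ s in Ioi t, M.excessFlow c T b v s) = D
  rw [excessFlow, senderFlow, senderFlow, lossFlow, lossFlow]
  have h3 : ∑ i, ((b t i - M.β i) ^ 2 + v t i) -
      ∑ i, ((M.biasPath c T t i - M.β i) ^ 2 + M.varPath c T t i) =
      M.multiplier T t * ∑ i, ((b t i - M.biasPath c T t i) ^ 2 +
      (v t i - M.varPath c T t i) * (1 - M.decayRate T t / M.price i)) +
      M.decayRate T t * M.multiplier T t * ∑ i, (v t i - M.varPath c T t i) / M.price i -
      (M.multiplier T t - 1) * (∑ i, (b t i ^ 2 + v t i) -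
        ∑ i, (M.biasPath c T t i ^ 2 + M.varPath c T t i)) := by
    rw [← Finset.sum_sub_distrib, ← Finset.sum_sub_distrib, Finset.mul_sum, Finset.mul_sum,
      Finset.mul_sum, ← Finset.sum_add_distrib, ← Finset.sum_sub_distrib]
    refine Finset.sum_congr rfl fun i _ => ?_
    rw [h2 i]
    ring
  linear_combination M.r * Real.exp (-M.r * t) * h3

/-- At every time, the variance path minimizes the Lagrangian: a component is fully revealed when
the bias decays at a lower rate than its price, and undisclosed when it decays at a higher rate. -/
theorem mul_one_sub_nonneg (hκ : ∀ i, 2 * M.κ i < M.r) (hmono : Monotone M.κ)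
    (h : M.IsSchedule c T) {b : ℝ → EuclideanSpace ℝ (Fin n)} {v : ℝ → Fin n → ℝ}
    (hf : M.Feasible b v) {t : ℝ} (ht : 0 ≤ t) (i : Fin n) :
    0 ≤ (v t i - M.varPath c T t i) * (1 - M.decayRate T t / M.price i) := by
  have hp := M.price_pos hκ i
  rcases le_or_gt (T (Fin.last n)) t with h1 | h1
  · rw [decayRate_eq_zero h.monotone h1,
      varPath_of_succ_le h ((h.monotone (Fin.le_last _)).trans h1)]
    simpa using hf.nonneg i t ht
  obtain ⟨k, hk⟩ := exists_mem_Ico_of_lt (h.zero ▸ ht) h1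
  rw [decayRate_eq h.monotone hk]
  rcases lt_trichotomy i k with hik | rfl | hik
  · rw [varPath_of_succ_le h ((h.monotone (Fin.succ_le_castSucc_iff.2 hik)).trans hk.1), sub_zero]
    refine mul_nonneg (hf.nonneg i t ht) (sub_nonneg.2 ((div_le_one hp).2 ?_))
    exact M.antitone_price hmono hik.le
  · rw [div_self hp.ne', sub_self, mul_zero]
  · rw [varPath_of_lt h ht (hk.2.trans_le (h.monotone (Fin.succ_le_castSucc_iff.2 hik)))]
    refine mul_nonneg_of_nonpos_of_nonpos (sub_nonpos.2 (hf.le_eta_initial i ht))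
      (sub_nonpos.2 ((one_le_div hp).2 ?_))
    exact M.antitone_price hmono hik.le

theorem sum_gap_nonneg (hκ : ∀ i, 2 * M.κ i < M.r) (hmono : Monotone M.κ)
    (h : M.IsSchedule c T) {b : ℝ → EuclideanSpace ℝ (Fin n)} {v : ℝ → Fin n → ℝ}
    (hf : M.Feasible b v) {t : ℝ} (ht : 0 ≤ t) :
    ∀ i ∈ Finset.univ, 0 ≤ (b t i - M.biasPath c T t i) ^ 2 +
      (v t i - M.varPath c T t i) * (1 - M.decayRate T t / M.price i) := fun i _ =>
  add_nonneg (sq_nonneg _) (mul_one_sub_nonneg hκ hmono h hf ht i)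

theorem dualGap_summands_nonneg (hr : 0 < M.r) (hκ : ∀ i, 2 * M.κ i < M.r) (hmono : Monotone M.κ)
    (h : M.IsSchedule c T) {b : ℝ → EuclideanSpace ℝ (Fin n)} {v : ℝ → Fin n → ℝ}
    (hf : M.Feasible b v) {t : ℝ} (ht : 0 ≤ t) :
    0 ≤ M.r * Real.exp (-M.r * t) * M.multiplier T t *
      ∑ i, ((b t i - M.biasPath c T t i) ^ 2 +
        (v t i - M.varPath c T t i) * (1 - M.decayRate T t / M.price i)) ∧
    0 ≤ M.decayRate T t * M.multiplier T t *
      (M.outsideLoss v t - ∫ u in Ioi t, M.lossFlow b v u) :=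
  ⟨mul_nonneg (mul_nonneg (mul_nonneg hr.le (Real.exp_pos _).le) (multiplier_nonneg T t))
      (Finset.sum_nonneg (sum_gap_nonneg hκ hmono h hf ht)),
    mul_nonneg (mul_nonneg (decayRate_nonneg hκ T t) (multiplier_nonneg T t))
      (sub_nonneg.2 (hf.integral_lossFlow_le ht))⟩

theorem dualGap_nonneg (hr : 0 < M.r) (hκ : ∀ i, 2 * M.κ i < M.r) (hmono : Monotone M.κ)
    (h : M.IsSchedule c T) {b : ℝ → EuclideanSpace ℝ (Fin n)} {v : ℝ → Fin n → ℝ}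
    (hf : M.Feasible b v) {t : ℝ} (ht : 0 ≤ t) : 0 ≤ M.dualGap c T b v t :=
  add_nonneg (dualGap_summands_nonneg hr hκ hmono h hf ht).1
    (dualGap_summands_nonneg hr hκ hmono h hf ht).2

theorem integrableOn_excessFlow (hr : 0 < M.r) (hσ : ∀ i, 0 < M.σ i)
    (hκ : ∀ i, 2 * M.κ i < M.r) (h : M.IsSchedule c T) (hβ : M.β ≠ 0)
    {b : ℝ → EuclideanSpace ℝ (Fin n)} {v : ℝ → Fin n → ℝ} (hf : M.Feasible b v) :
    IntegrableOn (M.excessFlow c T b v) (Ioi 0) :=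
  hf.integrableOn_lossFlow.sub (feasible_biasPath_varPath hr hσ hκ h hβ).integrableOn_lossFlow

theorem integrableOn_multiplier_mul (hκ : ∀ i, 2 * M.κ i < M.r) (T : Fin (n + 1) → ℝ) {f : ℝ → ℝ}
    {s : Set ℝ} (hf : IntegrableOn f s) : IntegrableOn (fun t => M.multiplier T t * f t) s := by
  refine hf.bdd_mul (c := ‖M.β‖ / M.sigmaHat) (continuous_multiplier T).aestronglyMeasurable
    (Filter.Eventually.of_forall fun t => ?_)
  rw [Real.norm_of_nonneg (multiplier_nonneg T t)]
  exact multiplier_le hκ T t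

/-- Summation by parts: the multipliers, integrated against the continuation values, cumulate. -/
theorem integral_decayRate_mul (hκ : ∀ i, 2 * M.κ i < M.r) (T : Fin (n + 1) → ℝ) {f : ℝ → ℝ}
    {a : ℝ} (hf : IntegrableOn f (Ioi a)) :
    IntegrableOn (fun t => M.decayRate T t * M.multiplier T t * ∫ s in Ioi t, f s) (Ioi a) ∧
    ∫ t in Ioi a, M.decayRate T t * M.multiplier T t * ∫ s in Ioi t, f s =
      (∫ s in Ioi a, M.multiplier T s * f s) - M.multiplier T a * ∫ s in Ioi a, f s := by
  have h1 := integrableOn_mul_integral_Ioi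
    (integrable_decayRate_mul_multiplier hκ T).integrableOn hf
  refine ⟨h1.1, h1.2.trans ?_⟩
  rw [← integral_const_mul,
    ← integral_sub (integrableOn_multiplier_mul hκ T hf) (hf.const_mul _)]
  refine setIntegral_congr_fun measurableSet_Ioi fun s hs => ?_
  simp only [multiplier_sub_multiplier hκ T (le_of_lt hs)]
  ring

theorem payoff_sub_payoff (hr : 0 < M.r) (hσ : ∀ i, 0 < M.σ i)
    (hκ : ∀ i, 2 * M.κ i < M.r) (h : M.IsSchedule c T) (hs : 0 < M.sigmaHat) (hβ : M.β ≠ 0)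
    {b : ℝ → EuclideanSpace ℝ (Fin n)} {v : ℝ → Fin n → ℝ} (hf : M.Feasible b v) :
    IntegrableOn (M.dualGap c T b v) (Ioi 0) ∧
    M.payoff (M.biasPath c T) (M.varPath c T) - M.payoff b v =
      (∫ t in Ioi 0, M.dualGap c T b v t) -
        (M.multiplier T 0 - 1) * ∫ s in Ioi 0, M.excessFlow c T b v s := by
  have hf0 := feasible_biasPath_varPath hr hσ hκ h hβ
  have i1 := hf.integrableOn_senderFlow hr
  have i2 := hf0.integrableOn_senderFlow hr
  have ie := integrableOn_excessFlow hr hσ hκ h hβ hf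
  have ime := integrableOn_multiplier_mul hκ T ie
  obtain ⟨iD, hD⟩ := integral_decayRate_mul hκ T ie
  have heq : EqOn (fun t => M.senderFlow b v t -
      M.senderFlow (M.biasPath c T) (M.varPath c T) t -
      M.decayRate T t * M.multiplier T t * (∫ s in Ioi t, M.excessFlow c T b v s) +
      (M.multiplier T t * M.excessFlow c T b v t - M.excessFlow c T b v t))
      (M.dualGap c T b v) (Ioi 0) := fun t ht => by
    simp only [senderFlow_sub_senderFlow hr hσ hκ h hs hβ hf (le_of_lt ht)]
    ring
  have j1 : IntegrableOn (fun t => M.senderFlow b v t -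
      M.senderFlow (M.biasPath c T) (M.varPath c T) t) (Ioi 0) := i1.sub i2
  have j2 : IntegrableOn (fun t => M.senderFlow b v t -
      M.senderFlow (M.biasPath c T) (M.varPath c T) t - M.decayRate T t * M.multiplier T t *
      (∫ s in Ioi t, M.excessFlow c T b v s)) (Ioi 0) := j1.sub iD
  have j3 : IntegrableOn (fun t => M.multiplier T t * M.excessFlow c T b v t -
      M.excessFlow c T b v t) (Ioi 0) := ime.sub ie
  refine ⟨IntegrableOn.congr_fun (j2.add j3) heq measurableSet_Ioi, ?_⟩
  rw [← setIntegral_congr_fun measurableSet_Ioi heq, integral_add j2 j3, integral_sub j1 iD,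
    integral_sub i1 i2, integral_sub ime ie, hD, payoff_eq, payoff_eq]
  ring

/-- The multiplier of obedience at time `0` is positive only if the initial variance is used up. -/
theorem multiplier_zero_sub_one_mul_nonpos (hr : 0 < M.r) (hσ : ∀ i, 0 < M.σ i)
    (hκ : ∀ i, 2 * M.κ i < M.r) (h : M.IsSchedule c T) (hs : 0 < M.sigmaHat) (hβ : M.β ≠ 0)
    {b : ℝ → EuclideanSpace ℝ (Fin n)} {v : ℝ → Fin n → ℝ} (hf : M.Feasible b v) :
    (M.multiplier T 0 - 1) * ∫ s in Ioi 0, M.excessFlow c T b v s ≤ 0 := by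
  have hn : M.multiplier T 0 * ‖M.biasPath c T 0‖ = ‖M.β‖ := by
    rw [← Real.norm_of_nonneg (multiplier_nonneg T 0), ← norm_smul,
      multiplier_smul_biasPath h hs hβ le_rfl]
  have hpos : 0 < ‖M.biasPath c T 0‖ := by
    rw [norm_biasPath_eq h hβ le_rfl]
    positivity
  rcases h.tight with ht | ht
  · rw [ht] at hn hpos
    rw [(mul_eq_right₀ hpos.ne').1 hn, sub_self, zero_mul]
  · refine mul_nonpos_of_nonneg_of_nonpos (sub_nonneg.2 ?_) ?_
    · by_contra! hlt
      have := mul_lt_mul_of_pos_right hlt hpos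
      linarith [h.bias_le]
    · rw [integral_excessFlow hr hσ hκ h hβ hf le_rfl]
      refine (sub_le_sub_right (hf.integral_lossFlow_le le_rfl) _).trans ?_
      rw [outsideLoss_sub]
      refine mul_nonpos_of_nonneg_of_nonpos (mul_nonneg hr.le (Real.exp_pos _).le)
        (Finset.sum_nonpos fun i _ => div_nonpos_of_nonpos_of_nonneg ?_ (M.price_pos hκ i).le)
      rw [ht i]
      exact sub_nonpos.2 (hf.initial i)

theorem isOptimal_biasPath_varPath (hr : 0 < M.r) (hσ : ∀ i, 0 < M.σ i)
    (hκ : ∀ i, 2 * M.κ i < M.r) (hmono : Monotone M.κ) (h : M.IsSchedule c T)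
    (hs : 0 < M.sigmaHat) (hβ : M.β ≠ 0) :
    M.IsOptimal (M.biasPath c T) (M.varPath c T) := by
  refine ⟨feasible_biasPath_varPath hr hσ hκ h hβ, fun b v hf => ?_⟩
  have h1 := (payoff_sub_payoff hr hσ hκ h hs hβ hf).2
  have h2 := multiplier_zero_sub_one_mul_nonpos hr hσ hκ h hs hβ hf
  have h3 : 0 ≤ ∫ t in Ioi 0, M.dualGap c T b v t :=
    setIntegral_nonneg measurableSet_Ioi fun t ht =>
      dualGap_nonneg hr hκ hmono h hf (le_of_lt ht)
  linarith

/-! ### Uniqueness of the optimum -/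

/-- Two feasible variance paths, the second of them continuous, that agree almost everywhere agree
at all positive times. -/
theorem Feasible.eq_of_ae_eq {b : ℝ → EuclideanSpace ℝ (Fin n)} {v w : ℝ → Fin n → ℝ}
    (hf : M.Feasible b v) {i : Fin n} (hw : Continuous fun t => w t i)
    (h : ∀ᵐ t ∂volume.restrict (Ioi (0 : ℝ)), v t i = w t i) {t : ℝ} (ht : 0 < t) :
    v t i = w t i := by
  refine (M.strictMono_eta i (-t)).injective ?_
  refine (hf.antitoneOn i).eq_of_ae_eq_continuousOn (g := fun t => M.η i (w t i) (-t)) ?_ ?_ ht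
  · have := continuous_expGap (M.κ i)
    unfold η
    fun_prop
  · filter_upwards [h] with s hs
    rw [hs]

theorem isOnlyOptimum_biasPath_varPath (hr : 0 < M.r) (hσ : ∀ i, 0 < M.σ i)
    (hκ : ∀ i, 2 * M.κ i < M.r) (hmono : StrictMono M.κ) (h : M.IsSchedule c T)
    (hs : 0 < M.sigmaHat) (hβ : M.β ≠ 0) :
    M.IsOnlyOptimum (M.biasPath c T) (M.varPath c T) := by
  rintro b v ⟨hf, hopt⟩
  have h1 := payoff_sub_payoff hr hσ hκ h hs hβ hf
  have h2 := multiplier_zero_sub_one_mul_nonpos hr hσ hκ h hs hβ hf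
  have h3 := hopt _ _ (feasible_biasPath_varPath hr hσ hκ h hβ)
  have h4 : 0 ≤ᵐ[volume.restrict (Ioi 0)] M.dualGap c T b v := by
    filter_upwards [ae_restrict_mem measurableSet_Ioi] with t ht
    exact dualGap_nonneg hr hκ hmono.monotone h hf (le_of_lt ht)
  have h5 : ∫ t in Ioi 0, M.dualGap c T b v t = 0 :=
    le_antisymm (by linarith) (integral_nonneg_of_ae h4)
  have hgap := (integral_eq_zero_iff_of_nonneg_ae h4 h1.1).1 h5
  have hm : ∀ t, 0 < M.multiplier T t := fun t =>
    mul_pos (div_pos (norm_pos_iff.2 hβ) hs) (Real.exp_pos _)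
  -- All summands of the duality gap vanish.
  have hkey : ∀ᵐ t ∂volume.restrict (Ioi (0 : ℝ)), (b t = M.biasPath c T t) ∧
      (∀ i, (v t i - M.varPath c T t i) * (1 - M.decayRate T t / M.price i) = 0) ∧
      M.decayRate T t * (M.outsideLoss v t - ∫ u in Ioi t, M.lossFlow b v u) = 0 := by
    filter_upwards [hgap, ae_restrict_mem measurableSet_Ioi] with t hgt ht
    obtain ⟨g1, g2⟩ := dualGap_summands_nonneg hr hκ hmono.monotone h hf (le_of_lt ht)
    obtain ⟨e1, e2⟩ := (add_eq_zero_iff_of_nonneg g1 g2).1 hgt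
    have e3 := (mul_eq_zero.1 e1).resolve_left
      (mul_pos (mul_pos hr (Real.exp_pos _)) (hm t)).ne'
    have e4 := (Finset.sum_eq_zero_iff_of_nonneg
      (sum_gap_nonneg hκ hmono.monotone h hf (le_of_lt ht))).1 e3
    have e5 := fun i => (add_eq_zero_iff_of_nonneg (sq_nonneg _)
      (mul_one_sub_nonneg hκ hmono.monotone h hf (le_of_lt ht) i)).1 (e4 i (Finset.mem_univ i))
    refine ⟨?_, fun i => (e5 i).2, ?_⟩
    · ext i
      exact sub_eq_zero.1 (pow_eq_zero_iff two_ne_zero |>.1 (e5 i).1)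
    · rw [mul_right_comm] at e2
      exact (mul_eq_zero.1 e2).resolve_right (hm t).ne'
  -- Hence the receiver's additional loss solves a linear differential equation.
  have hode : ∀ᵐ t ∂volume.restrict (Ioi (0 : ℝ)), M.excessFlow c T b v t =
      M.r * Real.exp (-M.r * t) * ∑ i, (v t i - M.varPath c T t i) ∧
      M.excessFlow c T b v t =
        M.decayRate T t * ∫ s in Ioi t, M.excessFlow c T b v s := by
    filter_upwards [hkey, ae_restrict_mem measurableSet_Ioi] with t hk ht
    obtain ⟨k1, k2, k3⟩ := hk
    have e1 : M.excessFlow c T b v t =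
        M.r * Real.exp (-M.r * t) * ∑ i, (v t i - M.varPath c T t i) := by
      rw [excessFlow, lossFlow, lossFlow, k1, ← mul_sub, ← Finset.sum_sub_distrib]
      simp
    refine ⟨e1, ?_⟩
    have e2 : ∑ i, (v t i - M.varPath c T t i) =
        M.decayRate T t * ∑ i, (v t i - M.varPath c T t i) / M.price i := by
      rw [Finset.mul_sum]
      refine Finset.sum_congr rfl fun i _ => ?_
      linear_combination k2 i
    have e3 := outsideLoss_sub (M := M) v (M.varPath c T) t
    rw [integral_excessFlow hr hσ hκ h hβ hf (le_of_lt ht), e1, e2]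
    linear_combination k3 - M.decayRate T t * e3
  have ie := integrableOn_excessFlow hr hσ hκ h hβ hf
  have hD : ∀ a, 0 ≤ a → ∫ s in Ioi a, M.excessFlow c T b v s = 0 := by
    intro a ha
    have e1 := (integral_decayRate_mul hκ T (ie.mono_set (Ioi_subset_Ioi ha))).2
    have e2 : ∫ t in Ioi a, M.decayRate T t * M.multiplier T t *
        ∫ s in Ioi t, M.excessFlow c T b v s =
        ∫ t in Ioi a, M.multiplier T t * M.excessFlow c T b v t := by
      refine integral_congr_ae ?_
      filter_upwards [ae_restrict_of_ae_restrict_of_subset (Ioi_subset_Ioi ha) hode] with t ht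
      linear_combination -M.multiplier T t * ht.2
    have e3 : M.multiplier T a * ∫ s in Ioi a, M.excessFlow c T b v s = 0 := by linarith
    exact (mul_eq_zero.1 e3).resolve_left (hm a).ne'
  have hv : ∀ᵐ t ∂volume.restrict (Ioi (0 : ℝ)), ∀ i, v t i = M.varPath c T t i := by
    filter_upwards [hkey, hode, ae_restrict_mem measurableSet_Ioi] with t hk ho ht
    obtain ⟨-, k2, -⟩ := hk
    have e1 : ∑ i, (v t i - M.varPath c T t i) = 0 := by
      have e2 := ho.1.symm.trans ho.2
      rw [hD t (le_of_lt ht), mul_zero] at e2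
      exact (mul_eq_zero.1 e2).resolve_left (mul_pos hr (Real.exp_pos _)).ne'
    -- The complementary slackness conditions leave at most one component undetermined.
    intro i
    by_contra hne
    have e2 : ∀ j, v t j - M.varPath c T t j ≠ 0 → M.price j = M.decayRate T t := fun j hj => by
      have := (mul_eq_zero.1 (k2 j)).resolve_left hj
      have hp := (M.price_pos hκ j).ne'
      field_simp at this
      linarith
    rw [Finset.sum_eq_single i] at e1
    · exact hne (sub_eq_zero.1 e1)
    · intro j _ hji
      by_contra hj
      have e3 := (e2 j hj).trans (e2 i (sub_ne_zero.2 hne)).symm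
      simp only [price] at e3
      exact hji (hmono.injective (by linarith))
    · simp
  constructor
  · rw [← restrict_Ioi_eq_restrict_Ici]
    filter_upwards [hkey] with t ht using ht.1
  · intro t ht
    ext i
    exact hf.eq_of_ae_eq (continuous_varPath hr hκ c T i) (hv.mono fun s hs => hs i) ht

/-! ### The case of a small bias -/

theorem isOptimal_const (hr : 0 < M.r) (hκ : ∀ i, 2 * M.κ i < M.r) (hβ : ‖M.β‖ ≤ M.sigmaHat) :
    M.IsOptimal (fun _ => M.β) (fun _ _ => 0) := by
  refine ⟨⟨aestronglyMeasurable_const, ?_, fun t _ => ?_, fun _ _ _ => le_rfl,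
    fun i t s _ hts => M.eta_nonneg le_rfl (sub_nonneg.2 hts.le), fun i => sq_nonneg _⟩,
    fun b v hf => ?_⟩
  · rw [integrableOn_Ici_iff_integrableOn_Ioi]
    exact (integrableOn_exp_neg_mul hr).mul_const _
  · refine (obedience_iff (fun _ => M.β) (fun _ _ => 0) t).2 ?_
    simp only [lossFlow, outsideLoss, mul_zero, add_zero]
    rw [integral_mul_const, integral_const_mul, integral_exp_mul_Ioi (neg_lt_zero.2 hr),
      ← M.sigmaHat_sq hκ, ← EuclideanSpace.real_norm_sq_eq]
    have h1 : M.r * (-Real.exp (-M.r * t) / -M.r) = Real.exp (-M.r * t) := by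
      field_simp
    rw [h1]
    gcongr
  · have h1 : M.payoff (fun _ => M.β) (fun _ _ => 0) = 0 := by simp [payoff]
    rw [h1, payoff_eq]
    refine neg_nonpos.2 (setIntegral_nonneg measurableSet_Ioi fun t ht => ?_)
    exact mul_nonneg (mul_nonneg hr.le (Real.exp_pos _).le)
      (Finset.sum_nonneg fun i _ => add_nonneg (sq_nonneg _) (hf.nonneg i t (le_of_lt ht)))

theorem isOnlyOptimum_const (hr : 0 < M.r) (hκ : ∀ i, 2 * M.κ i < M.r)
    (hβ : ‖M.β‖ ≤ M.sigmaHat) : M.IsOnlyOptimum (fun _ => M.β) (fun _ _ => 0) := by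
  rintro b v ⟨hf, hopt⟩
  have h1 : M.payoff (fun _ => M.β) (fun _ _ => 0) = 0 := by simp [payoff]
  have h2 := hopt _ _ (isOptimal_const hr hκ hβ).1
  rw [h1, payoff_eq] at h2
  have hnn : ∀ t, 0 ≤ t → ∀ i ∈ Finset.univ, 0 ≤ (b t i - M.β i) ^ 2 + v t i :=
    fun t ht i _ => add_nonneg (sq_nonneg _) (hf.nonneg i t ht)
  have h3 : 0 ≤ᵐ[volume.restrict (Ioi 0)] M.senderFlow b v := by
    filter_upwards [ae_restrict_mem measurableSet_Ioi] with t ht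
    exact mul_nonneg (mul_nonneg hr.le (Real.exp_pos _).le)
      (Finset.sum_nonneg (hnn t (le_of_lt ht)))
  have h4 : ∫ t in Ioi 0, M.senderFlow b v t = 0 :=
    le_antisymm (by linarith) (integral_nonneg_of_ae h3)
  have h5 := (integral_eq_zero_iff_of_nonneg_ae h3 (hf.integrableOn_senderFlow hr)).1 h4
  have hkey : ∀ᵐ t ∂volume.restrict (Ioi (0 : ℝ)), b t = M.β ∧ ∀ i, v t i = 0 := by
    filter_upwards [h5, ae_restrict_mem measurableSet_Ioi] with t h0 ht
    have e1 := (mul_eq_zero.1 h0).resolve_left (mul_pos hr (Real.exp_pos _)).ne'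
    have e2 := fun i => (add_eq_zero_iff_of_nonneg (sq_nonneg _)
      (hf.nonneg i t (le_of_lt ht))).1
      ((Finset.sum_eq_zero_iff_of_nonneg (hnn t (le_of_lt ht))).1 e1 i (Finset.mem_univ i))
    refine ⟨?_, fun i => (e2 i).2⟩
    ext i
    exact sub_eq_zero.1 (pow_eq_zero_iff two_ne_zero |>.1 (e2 i).1)
  constructor
  · rw [← restrict_Ioi_eq_restrict_Ici]
    filter_upwards [hkey] with t ht using ht.1
  · intro t ht
    ext i
    exact hf.eq_of_ae_eq (w := fun _ _ => 0) continuous_const (hkey.mono fun s hs => hs.2 i) ht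

end OUModel

theorem theorem3 {n : ℕ} (M : OUModel n) (hr : 0 < M.r) (hσ : ∀ i, 0 < M.σ i)
    (hκ : ∀ i, 2 * M.κ i < M.r) (hmono : Monotone M.κ) :
    (‖M.β‖ ≤ M.sigmaHat →
      M.IsOptimal (fun _ => M.β) (fun _ _ => 0) ∧
      (StrictMono M.κ → M.IsOnlyOptimum (fun _ => M.β) (fun _ _ => 0))) ∧
    (M.sigmaHat < ‖M.β‖ →
      (∃! p : Fin (n + 1) × (Fin (n + 1) → ℝ), M.IsSchedule p.1 p.2) ∧
      ∀ (c : Fin (n + 1)) (T : Fin (n + 1) → ℝ), M.IsSchedule c T →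
        (c = Fin.last n ↔ ∀ i, M.σ₀ i = 0) ∧
        M.IsOptimal (M.biasPath c T) (M.varPath c T) ∧
        (StrictMono M.κ → M.IsOnlyOptimum (M.biasPath c T) (M.varPath c T)) ∧
        (∀ i : Fin n, ∀ t ∈ Set.Icc (T i.castSucc) (T i.succ),
          ‖M.biasPath c T t‖ =
            ‖M.biasPath c T (T i.castSucc)‖ * Real.exp (-(M.r - 2 * M.κ i) * (t - T i.castSucc))) ∧
        (∀ i : Fin n, ∀ t, 0 < t → (M.varPath c T t i = 0 ↔ T i.succ ≤ t))) := by
  refine ⟨fun hβ => ⟨OUModel.isOptimal_const hr hκ hβ,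
    fun _ => OUModel.isOnlyOptimum_const hr hκ hβ⟩, fun hβ =>
    ⟨OUModel.existsUnique_isSchedule hr hσ hκ hmono hβ, fun c T h => ?_⟩⟩
  have hβ0 : M.β ≠ 0 := norm_pos_iff.1 ((Real.sqrt_nonneg _).trans_lt hβ)
  have hs : 0 < M.sigmaHat := by
    have : Nonempty (Fin n) := by
      by_contra hn
      rw [not_nonempty_iff] at hn
      exact hβ0 (Subsingleton.elim _ _)
    exact M.sigmaHat_pos hσ hκ this.some
  exact ⟨h.eq_last_iff hr hσ hκ hβ, OUModel.isOptimal_biasPath_varPath hr hσ hκ hmono h hs hβ0,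
    fun hstrict => OUModel.isOnlyOptimum_biasPath_varPath hr hσ hκ hstrict h hs hβ0,
    fun i t ht => OUModel.norm_biasPath_decay h hβ0 i ht,
    fun i t ht => OUModel.varPath_eq_zero_iff hr hσ hκ h i ht⟩

end
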